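/- Let $t\ge 0$, $T=\{1,\dots,t\}$, $\hat T=\{1,\dots,t+1\}$. **Diagrams.** A diagram of order $t+1$ is a row of columns $C_1,\dots,C_{t+1}$ of blocks, with heights $ht\,C_i\in\mathbb N$, such that every column having no column of at least its height to its left (resp. right) has even (resp. odd) height or has the maximal height $ht\,\mathscr D$ of the diagram $\mathscr D$. Let $R_j$ be the $j$-th row. Two columns of height $\ge j$ are neighbours at level $j$ if all columns strictly between them have height $<j$. The strongly extremal column is the leftmost (resp. rightmost) column of maximal height $r$ if $r$ is odd (resp. even); it is $C_{t+1}$ if the diagram is empty. Adjoining a domino means adding two blocks to a column $C$ of height $m$ so that $C$ becomes the left (if $m$ is even) or right (if $m$ is odd) neighbour at levels $m+1,m+2$ of a column of height $\ge m+2$; a diagram is complete if no domino can be adjoined, and reduced if no two adjacent non-empty rows have the same number of blocks. Let $H$ be the set of classes of diagrams under the equivalence relation generated by domino adjunction, by adding one block to the strongly extremal column, and by removing two adjacent rows with the same number of blocks. The class $v$ of $\mathscr D$ has the label $i_v=j$, where $C_j$ is the strongly extremal column of $\mathscr D$ (this depends only on the class). **Tableaux.** Let $B(i,j)$ be the block of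 $C_i$ in row $j$. The rightmost block of each odd row and the leftmost block of each even row have no entry. The other blocks have entries $b(i,j)\in T$: $b(i,1)=i$, and $b(i,j+1)=b(k,j)$ where $C_k$ is the left (resp. right) neighbour of $C_i$ at level $j$ for $j$ odd (resp. even). Put also $b(i,0)=i-1$ for $i>1$. The relations of $\mathscr D$ are the following, for all $j\ge1$ and all $C_x,C_y$, $x<y$, that are neighbours at level $j$. If $j$ is even, $b(y,j)<b(k,j-1)$ for every $k$ with $x\le k<y$ and $ht\,C_k\ge j-1$, except the left neighbour of $C_y$ at level $j-1$. If $j$ is odd, $b(x,j)<b(k,j-1)$ for every $k$ with $x<k\le y$ and $ht\,C_k\ge j-1$, except the right neighbour of $C_x$ at level $j-1$. **Graph of links.** All graphs are undirected, with vertex labels $i_v\in\hat T$ and edge labels $i_{v,v'}\in T$. The graph $\mathscr G_H$ has vertex set $H$. There is an edge with label $i$ between the classes of $\mathscr D$ and $\mathscr D'$ whenever $\mathscr D$ is complete and reduced and $\mathscr D'$ is obtained from $\mathscr D$ by putting one block, which has entry $i$ in $\mathscr D'$, on a column that is not strongly extremal in $\mathscr D$ but is so in $\mathscr D'$. Let $\mathbf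 c$ be a linear order on $T$, thought of as the order of coefficients $c_1,\dots,c_t$ in general position. Let $H(\mathbf c)\subset H$ be the set of classes of complete diagrams all of whose relations hold in $\mathbf c$ (i.e. $c_b<c_{b'}$ for each relation $b<b'$), and let $\mathscr G_{H(\mathbf c)}$ be the subgraph of $\mathscr G_H$ with vertex set $H(\mathbf c)$ and all links between its elements. **The graph $\mathscr G(\mathbf c)$.** For $t=0$ it is a single vertex with label $1$. (Hence for $t=1$ it is two vertices labelled $1,2$ joined by an edge labelled $1$.) For $t\ge 1$ let $c_s$ be the largest element of $\mathbf c$ and let $\mathbf c^-$ be the order on $\{1,\dots,t-1\}$ given by $c_1,\dots,c_{s-1},c_{s+1},\dots,c_t$. Take two copies $\mathscr G^{\pm}$ of $\mathscr G(\mathbf c^-)$. In both, raise by one the edge labels $\ge s$; in $\mathscr G^+$ (resp. $\mathscr G^-$) raise by one the vertex labels $\ge s$ (resp. $\ge s+1$). Join each vertex of $\mathscr G^+$ whose new label is $s+1$ to its copy in $\mathscr G^-$ by an edge with label $s$. **Functions.** Let $c_j$ ($j\in T$) and $m^i$ ($i\in\hat T$) be indeterminates and $\hat H=\{\sum_i d_im^i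 : d_i\in\sum_j\mathbb Zc_j\}$. Let $r^i-r^{i+1}=m^i+m^{i+1}$ for $i\in T$, and $h=-\sum_{i\in T}c_im^i$. A pointed chain in a graph is a family of vertices $v_{t+1},\dots,v_1$ with $i_{v_i}=i$ for $i\in\hat T$ and such that $(v_{i+1},v_i)$ is an edge with label $i$ for $i\in T$. **Proposition.** For every linear order $\mathbf c$ on $T$ there is an injective map $\theta:V(\mathscr G(\mathbf c))\to V(\mathscr G_{H(\mathbf c)})=H(\mathbf c)$ such that $i_{\theta(v)}=i_v$ for every vertex $v$ and, for every edge $(v,v')$ of $\mathscr G(\mathbf c)$, the pair $(\theta(v),\theta(v'))$ is an edge of $\mathscr G_{H(\mathbf c)}$ whose (unique) label is $i_{\theta(v),\theta(v')}=i_{v,v'}$. Moreover $\mathscr G(\mathbf c)$ has property $P_9$: it has a unique pointed chain $v_{t+1},\dots,v_1$, there is a unique map $v\mapsto f_v\in\hat H$ on its vertices with $f_{v_{t+1}}=h$ and $f_v-f_{v'}=c_{i_{v,v'}}(r^{i_v}-r^{i_{v'}})$ for every edge $(v,v')$, and this map is injective. -/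

import Mathlib

open Function

namespace Crystal

/-! Columns `C_1, …, C_{t+1}` are indexed by `Fin (t + 1)` and the coefficients `c_1, …, c_t` by
`Fin t`, both starting from `0`. So the index `i ∈ {1, …, t}` corresponds to `b : Fin t` with
`i = b + 1`; the column `C_i` is then `b.castSucc` and the column `C_{i+1}` is `b.succ`. -/

/-! ### Diagrams -/

/-- A diagram of order `t + 1`: the heights of its `t + 1` columns, subject to the left and right
boundary conditions. A column is left (right) extremal if no column on its left (right) is at
least as high; its height must then be even (odd) or be the height of the diagram. -/
@[ext]
structure Diagram (t : ℕ) where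
  ht : Fin (t + 1) → ℕ
  left_boundary : ∀ i, (∀ l, l < i → ht l < ht i) → Even (ht i) ∨ ∀ l, ht l ≤ ht i
  right_boundary : ∀ i, (∀ l, i < l → ht l < ht i) → Odd (ht i) ∨ ∀ l, ht l ≤ ht i

namespace Diagram

variable {t : ℕ}

/-- Columns `a < b` of height `≥ j` are neighbours at level `j` if all columns strictly between
them have height `< j`. -/
def Neighbours (D : Diagram t) (j : ℕ) (a b : Fin (t + 1)) : Prop :=
  a < b ∧ j ≤ D.ht a ∧ j ≤ D.ht b ∧ ∀ l, a < l → l < b → D.ht l < j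

/-- A left even domino or a right odd domino can be adjoined to the column `i`. With `m` the height
of the column, this says that `m` is even (odd) and that the column, once raised to height
`m + 2`, is the left (right) neighbour at the levels `m + 1`, `m + 2` of a column `k` of
height `≥ m + 2`. -/
def CanAdjoin (D : Diagram t) (i : Fin (t + 1)) : Prop :=
  (Even (D.ht i) ∧ ∃ k, i < k ∧ D.ht i + 2 ≤ D.ht k ∧ ∀ l, i < l → l < k → D.ht l ≤ D.ht i) ∨
  (Odd (D.ht i) ∧ ∃ k, k < i ∧ D.ht i + 2 ≤ D.ht k ∧ ∀ l, k < l → l < i → D.ht l ≤ D.ht i)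

/-- A diagram is complete if no left even or right odd domino can be adjoined to it. -/
def Complete (D : Diagram t) : Prop := ∀ i, ¬ D.CanAdjoin i

/-- A diagram is reduced if no two adjacent (non-empty) rows `R_m`, `R_{m+1}` have the same number
of blocks. The blocks of `R_m` that are not below a block of `R_{m+1}` are the tops of the
columns of height `m`, so this says that every height `1 ≤ m ≤ ht D` is the height of a column. -/
def Reduced (D : Diagram t) : Prop :=
  ∀ m, 1 ≤ m → (∃ l, m ≤ D.ht l) → ∃ l, D.ht l = m

/-- The column `j` is strongly extremal: it has maximal height `r`, and it is the leftmost
(rightmost) column of height `r` if `r` is odd (even). For the empty diagram this is `C_{t+1}`. -/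
def IsStronglyExtremal (D : Diagram t) (j : Fin (t + 1)) : Prop :=
  (∀ l, D.ht l ≤ D.ht j) ∧
  (Odd (D.ht j) → ∀ l, l < j → D.ht l < D.ht j) ∧
  (Even (D.ht j) → ∀ l, j < l → D.ht l < D.ht j)

theorem IsStronglyExtremal.unique {D : Diagram t} {j k : Fin (t + 1)}
    (hj : D.IsStronglyExtremal j) (hk : D.IsStronglyExtremal k) : j = k := by
  have e : D.ht j = D.ht k := le_antisymm (hk.1 j) (hj.1 k)
  rcases lt_trichotomy j k with h | h | h
  · rcases Nat.even_or_odd (D.ht j) with p | p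
    · have := hj.2.2 p k h
      omega
    · have := hk.2.1 (e ▸ p) j h
      omega
  · exact h
  · rcases Nat.even_or_odd (D.ht j) with p | p
    · have := hk.2.2 (e ▸ p) j h
      omega
    · have := hj.2.1 p k h
      omega

theorem exists_stronglyExtremal (D : Diagram t) : ∃ j, D.IsStronglyExtremal j := by
  classical
  obtain ⟨m, hm⟩ := Finite.exists_max D.ht
  let S : Finset (Fin (t + 1)) := Finset.univ.filter fun l => D.ht l = D.ht m
  have hS : S.Nonempty := ⟨m, by simp [S]⟩
  rcases Nat.even_or_odd (D.ht m) with p | p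
  · have h : D.ht (S.max' hS) = D.ht m := by
      have := S.max'_mem hS
      simpa [S] using this
    refine ⟨S.max' hS, fun l => h ▸ hm l, fun q => ?_, fun _ l hl => ?_⟩
    · rw [h] at q
      exact absurd p (Nat.not_even_iff_odd.2 q)
    · rw [h]
      refine lt_of_le_of_ne (hm l) fun e => ?_
      exact absurd (S.le_max' l (by simp [S, e])) (not_le.2 hl)
  · have h : D.ht (S.min' hS) = D.ht m := by
      have := S.min'_mem hS
      simpa [S] using this
    refine ⟨S.min' hS, fun l => h ▸ hm l, fun _ l hl => ?_, fun q => ?_⟩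
    · rw [h]
      refine lt_of_le_of_ne (hm l) fun e => ?_
      exact absurd (S.min'_le l (by simp [S, e])) (not_le.2 hl)
    · rw [h] at q
      exact absurd q (Nat.not_even_iff_odd.2 p)

/-- The unique strongly extremal column. -/
noncomputable def strongCol (D : Diagram t) : Fin (t + 1) := D.exists_stronglyExtremal.choose

theorem strongCol_spec (D : Diagram t) : D.IsStronglyExtremal D.strongCol :=
  D.exists_stronglyExtremal.choose_spec

/-- The elementary operations that generate the equivalence of diagrams. -/
inductive Step : Diagram t → Diagram t → Prop
  /-- Adjunction of a left even or right odd domino to the column `i`. -/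
  | domino (D D' : Diagram t) (i : Fin (t + 1)) (hi : D.CanAdjoin i)
      (h : D'.ht = update D.ht i (D.ht i + 2)) : Step D D'
  /-- Adjunction of a half-domino: one block is put on the strongly extremal column `j`. -/
  | halfDomino (D D' : Diagram t) (j : Fin (t + 1)) (hj : D.IsStronglyExtremal j)
      (h : D'.ht = update D.ht j (D.ht j + 1)) : Step D D'
  /-- Removal of the adjacent rows `R_{i+1}`, `R_{i+2}` when they have the same number of blocks,
  that is, when no column has height `i + 1`. -/
  | removeRows (D D' : Diagram t) (i : ℕ) (hi : ∀ l, D.ht l ≠ i + 1)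
      (h : ∀ l, D'.ht l = if i + 2 ≤ D.ht l then D.ht l - 2 else D.ht l) : Step D D'

theorem Step.stronglyExtremal {D D' : Diagram t} (s : Step D D') {j : Fin (t + 1)}
    (hj : D.IsStronglyExtremal j) : D'.IsStronglyExtremal j := by
  obtain ⟨h1, h2, h3⟩ := hj
  cases s with
  | domino i hi h =>
    obtain ⟨k, hk⟩ : ∃ k, D.ht i + 2 ≤ D.ht k := by
      rcases hi with ⟨_, k, _, hk, _⟩ | ⟨_, k, _, hk, _⟩ <;> exact ⟨k, hk⟩
    have hkj := h1 k
    have hne : j ≠ i := by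
      rintro rfl
      omega
    have ej : D'.ht j = D.ht j := by rw [h, update_of_ne hne]
    have ei : D'.ht i = D.ht i + 2 := by rw [h, update_self]
    have el : ∀ l, l ≠ i → D'.ht l = D.ht l := fun l hl => by rw [h, update_of_ne hl]
    refine ⟨fun l => ?_, fun p l hl => ?_, fun p l hl => ?_⟩
    · rw [ej]
      by_cases hli : l = i
      · subst hli
        omega
      · rw [el l hli]
        exact h1 l
    · rw [ej] at p ⊢
      by_cases hli : l = i
      · subst hli
        rcases hi with ⟨q, _⟩ | ⟨_, k', hk', hkk, _⟩
        · obtain ⟨a, ha⟩ := q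
          obtain ⟨b, hb⟩ := p
          omega
        · have := h2 p k' (hk'.trans hl)
          omega
      · rw [el l hli]
        exact h2 p l hl
    · rw [ej] at p ⊢
      by_cases hli : l = i
      · subst hli
        rcases hi with ⟨_, k', hk', hkk, _⟩ | ⟨q, _⟩
        · have := h3 p k' (hl.trans hk')
          omega
        · obtain ⟨a, ha⟩ := q
          obtain ⟨b, hb⟩ := p
          omega
      · rw [el l hli]
        exact h3 p l hl
  | halfDomino j' hj' h =>
    have e : j = j' := IsStronglyExtremal.unique ⟨h1, h2, h3⟩ hj'
    subst e
    have ej : D'.ht j = D.ht j + 1 := by rw [h, update_self]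
    have el : ∀ l, l ≠ j → D'.ht l < D'.ht j := fun l hl => by
      rw [ej, h, update_of_ne hl]
      have := h1 l
      omega
    refine ⟨fun l => ?_, fun _ l hl => el l hl.ne, fun _ l hl => el l hl.ne'⟩
    by_cases hl : l = j
    · rw [hl]
    · exact (el l hl).le
  | removeRows i hi h =>
    have key : ∀ l, D.ht l < D.ht j → D'.ht l < D'.ht j ∨ (D.ht l = i ∧ D.ht j = i + 2) := by
      intro l hl
      have a := hi l
      have b := hi j
      rw [h l, h j]
      split_ifs <;> omega
    have par : Even (D'.ht j) ↔ Even (D.ht j) := by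
      rw [h j]
      split_ifs with q
      · rw [Nat.even_sub (by omega)]
        simp
      · rfl
    refine ⟨fun l => ?_, fun p l hl => ?_, fun p l hl => ?_⟩
    · have a := hi l
      have b := hi j
      have := h1 l
      rw [h l, h j]
      split_ifs <;> omega
    · have p' : Odd (D.ht j) := by
        rw [← Nat.not_even_iff_odd, ← par, Nat.not_even_iff_odd]
        exact p
      rcases key l (h2 p' l hl) with r | ⟨r1, r2⟩
      · exact r
      exfalso
      classical
      let S : Finset (Fin (t + 1)) := Finset.univ.filter fun l => i ≤ D.ht l
      have hS : S.Nonempty := ⟨l, by simp [S, r1]⟩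
      have hm : i ≤ D.ht (S.min' hS) := by
        have := S.min'_mem hS
        simpa [S] using this
      have hml : S.min' hS ≤ l := S.min'_le l (by simp [S, r1])
      have hlt := h2 p' _ (lt_of_le_of_lt hml hl)
      have hmi : D.ht (S.min' hS) = i := by
        have := hi (S.min' hS)
        omega
      rcases D.left_boundary (S.min' hS) (fun l' hl' => by
        by_contra hc
        exact absurd (S.min'_le l' (by simp [S]; omega)) (not_le.2 hl')) with q | q
      · obtain ⟨x, hx⟩ := q
        obtain ⟨y, hy⟩ := p'
        omega
      · have := q j
        omega
    · have p' : Even (D.ht j) := par.1 p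
      rcases key l (h3 p' l hl) with r | ⟨r1, r2⟩
      · exact r
      exfalso
      classical
      let S : Finset (Fin (t + 1)) := Finset.univ.filter fun l => i ≤ D.ht l
      have hS : S.Nonempty := ⟨l, by simp [S, r1]⟩
      have hm : i ≤ D.ht (S.max' hS) := by
        have := S.max'_mem hS
        simpa [S] using this
      have hml : l ≤ S.max' hS := S.le_max' l (by simp [S, r1])
      have hlt := h3 p' _ (lt_of_lt_of_le hl hml)
      have hmi : D.ht (S.max' hS) = i := by
        have := hi (S.max' hS)
        omega
      rcases D.right_boundary (S.max' hS) (fun l' hl' => by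
        by_contra hc
        exact absurd (S.le_max' l' (by simp [S]; omega)) (not_le.2 hl')) with q | q
      · obtain ⟨x, hx⟩ := q
        obtain ⟨y, hy⟩ := p'
        omega
      · have := q j
        omega

theorem Step.strongCol_eq {D D' : Diagram t} (s : Step D D') : D.strongCol = D'.strongCol :=
  (s.stronglyExtremal D.strongCol_spec).unique D'.strongCol_spec

/-! ### Tableaux -/

/-- `D.HasEntry j i b`: the entry of the tableau of `D` at the block `B(i, j)` exists and is `b`.

Row `0` is the usual bookkeeping row: `C_{i+1}` carries `i` there. For `j ≥ 1`, the extremal block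
of row `j + 1`, i.e. its leftmost (rightmost) block if `j` is odd (even), has no entry; any
other block `B(i, j + 1)` carries the entry `b(k, j)`, with `C_k` the left (right)
neighbour of `C_i` at level `j` for `j` odd (even). For row `1` this says `b(i, 1) = i`
for `i ≤ t`, see `hasEntry_one`. -/
def HasEntry (D : Diagram t) : ℕ → Fin (t + 1) → Fin t → Prop
  | 0, i, b => i = b.succ
  | j + 1, i, b => j + 1 ≤ D.ht i ∧
      ((Odd j ∧ (∃ l, l < i ∧ j + 1 ≤ D.ht l) ∧
          ∃ k, D.Neighbours j k i ∧ D.HasEntry j k b) ∨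
       (Even j ∧ (∃ l, i < l ∧ j + 1 ≤ D.ht l) ∧
          ∃ k, D.Neighbours j i k ∧ D.HasEntry j k b))

/-- In the first row every non-empty column `C_i`, `i ≤ t`, carries the entry `i`. -/
theorem hasEntry_one (D : Diagram t) (i : Fin (t + 1)) (b : Fin t) :
    D.HasEntry 1 i b ↔ 1 ≤ D.ht i ∧ i = b.castSucc := by
  have hlast : ∀ l, D.ht l ≤ D.ht (Fin.last t) ∨ Odd (D.ht (Fin.last t)) := fun l => by
    rcases D.right_boundary (Fin.last t) (fun l hl => absurd hl (not_lt.2 (Fin.le_last l))) with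
      h | h
    · exact Or.inr h
    · exact Or.inl (h l)
  constructor
  · rintro ⟨h, ⟨h0, _⟩ | ⟨_, _, k, ⟨hk, _, _, hbt⟩, hkb⟩⟩
    · exact absurd h0 (by decide)
    · refine ⟨h, ?_⟩
      have hkb : k = b.succ := hkb
      subst hkb
      rcases lt_or_ge i b.castSucc with q | q
      · exact absurd (hbt b.castSucc q Fin.castSucc_lt_succ) (Nat.not_lt_zero _)
      · refine le_antisymm ?_ q
        rw [Fin.lt_def] at hk
        rw [Fin.le_def]
        simp only [Fin.val_succ, Fin.val_castSucc] at *
        omega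
  · rintro ⟨h, rfl⟩
    refine ⟨by simpa using h, Or.inr ⟨by simp, ⟨Fin.last t, Fin.castSucc_lt_last b, ?_⟩,
      b.succ, ⟨Fin.castSucc_lt_succ, Nat.zero_le _, Nat.zero_le _, ?_⟩, rfl⟩⟩
    · change 1 ≤ _
      rcases hlast b.castSucc with q | ⟨x, hx⟩ <;> omega
    · intro l h1 h2
      rw [Fin.lt_def] at h1 h2
      simp only [Fin.val_succ, Fin.val_castSucc] at *
      omega

/-- `D.Rel b b'` is the relation `b < b'` in the partial order `P` of the tableau of `D`.

For `j` even: `C_y` has left neighbour `C_x` at level `j`, and `b'` runs over the entries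
`b(k, j - 1)` where `C_k` is `C_x` or a column of height `j - 1` between `C_x` and `C_y`, other
than the left neighbour of `C_y` at level `j - 1`; then `b(y, j) < b(k, j - 1)`.
For `j` odd: `C_x` has right neighbour `C_y` at level `j`, and `b'` runs over the entries
`b(k, j - 1)` where `C_k` is `C_y` or a column of height `j - 1` between `C_x` and `C_y`, other
than the right neighbour of `C_x` at level `j - 1`; then `b(x, j) < b(k, j - 1)`. -/
def Rel (D : Diagram t) (b b' : Fin t) : Prop :=
  ∃ (j : ℕ) (x y k : Fin (t + 1)), 1 ≤ j ∧ D.Neighbours j x y ∧ j - 1 ≤ D.ht k ∧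
    ((Even j ∧ x ≤ k ∧ k < y ∧ ¬ D.Neighbours (j - 1) k y ∧
        D.HasEntry j y b ∧ D.HasEntry (j - 1) k b') ∨
     (Odd j ∧ x < k ∧ k ≤ y ∧ ¬ D.Neighbours (j - 1) x k ∧
        D.HasEntry j x b ∧ D.HasEntry (j - 1) k b'))

end Diagram

/-- The set `H = H^{t+1}` of equivalence classes of diagrams of order `t + 1`, for the equivalence
relation generated by the elementary operations. -/
def H (t : ℕ) : Type := Quot (Diagram.Step (t := t))

/-- The class of a diagram. -/
def H.mk {t : ℕ} (D : Diagram t) : H t := Quot.mk _ D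

/-- The label `i_v` of a class: the strongly extremal column of any of its diagrams. -/
noncomputable def H.label {t : ℕ} (x : H t) : Fin (t + 1) :=
  Quot.lift Diagram.strongCol (fun _ _ s => s.strongCol_eq) x

/-- A single block linkage from `x` to `y` with label `i`: a complete reduced diagram `D` in `x`
gives a diagram `D'` in `y` when one block is put on top of a column `k` of `D`; here `k` is not
the strongly extremal column of `D` but is that of `D'`, and the new block has entry `i`. -/
def H.Linkage {t : ℕ} (i : Fin t) (x y : H t) : Prop :=
  ∃ (D D' : Diagram t) (k : Fin (t + 1)), H.mk D = x ∧ H.mk D' = y ∧ D.Complete ∧ D.Reduced ∧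
    D'.ht = update D.ht k (D.ht k + 1) ∧ ¬ D.IsStronglyExtremal k ∧ D'.IsStronglyExtremal k ∧
    D'.HasEntry (D.ht k + 1) k i

/-! ### Labelled graphs -/

/-- An undirected graph with vertices labelled by `{1, …, t+1}` and edges labelled by `{1, …, t}`;
`link i v w` says that `(v, w)` is an edge which carries the label `i`. -/
structure LGraph (t : ℕ) (V : Type*) where
  label : V → Fin (t + 1)
  link : Fin t → V → V → Prop
  symm : ∀ i v w, link i v w → link i w v

/-- The graph of links of `H`. -/
noncomputable def linkGraph (t : ℕ) : LGraph t (H t) where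
  label := H.label
  link i x y := H.Linkage i x y ∨ H.Linkage i y x
  symm _ _ _ h := h.symm

/-- The subgraph of `G` with vertex set `S` and all the edges of `G` between elements of `S`. -/
def LGraph.restrict {t : ℕ} {V : Type*} (G : LGraph t V) (S : Set V) : LGraph t S where
  label v := G.label v
  link i v w := G.link i v w
  symm i v w h := G.symm i v w h

/-- `H(c)`: the classes of the complete tableaux whose relations hold in the linear order `c`. The
linear order on the index set `{1, …, t}` is the one that an injective map `c` into a linearly
ordered set induces on it. -/
def HSet {α : Type*} [LinearOrder α] {t : ℕ} (c : Fin t → α) : Set (H t) :=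
  {x | ∃ D : Diagram t, H.mk D = x ∧ D.Complete ∧ ∀ b b', D.Rel b b' → c b < c b'}

/-- `θ` is a graph embedding that preserves the labels on vertices and on edges: it is injective
and sends an edge with label `i` to an edge whose one and only label is `i`. -/
structure IsLabelledEmbedding {t : ℕ} {V W : Type*} (G : LGraph t V) (G' : LGraph t W)
    (θ : V → W) : Prop where
  injective : Injective θ
  label_eq : ∀ v, G'.label (θ v) = G.label v
  link_iff : ∀ i v w, G.link i v w → ∀ i', G'.link i' (θ v) (θ w) ↔ i' = i

/-! ### Binary fusion -/

/-- Binary fusion of two copies `G⁺` (`Sum.inl`) and `G⁻` (`Sum.inr`) of `G` at `s`. Edge labels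
`j ≥ s` are raised by one in both copies; vertex labels `j ≥ s` are raised by one in `G⁺` and
vertex labels `j ≥ s + 1` are raised by one in `G⁻`. Each vertex of `G⁺` with (new) label
`s + 1` is joined to its copy in `G⁻` by an edge with label `s`. -/
def LGraph.fusion {t : ℕ} {V : Type*} (s : Fin (t + 1)) (G : LGraph t V) :
    LGraph (t + 1) (V ⊕ V) where
  label
    | Sum.inl v => s.castSucc.succAbove (G.label v)
    | Sum.inr v => s.succ.succAbove (G.label v)
  link i
    | Sum.inl v, Sum.inl w => ∃ j, i = s.succAbove j ∧ G.link j v w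
    | Sum.inr v, Sum.inr w => ∃ j, i = s.succAbove j ∧ G.link j v w
    | Sum.inl v, Sum.inr w => i = s ∧ v = w ∧ s.castSucc.succAbove (G.label v) = s.succ
    | Sum.inr v, Sum.inl w => i = s ∧ v = w ∧ s.castSucc.succAbove (G.label v) = s.succ
  symm i v w h := by
    rcases v with v | v <;> rcases w with w | w
    · obtain ⟨j, rfl, h⟩ := h
      exact ⟨j, rfl, G.symm _ _ _ h⟩
    · obtain ⟨rfl, rfl, h⟩ := h
      exact ⟨rfl, rfl, h⟩
    · obtain ⟨rfl, rfl, h⟩ := h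
      exact ⟨rfl, rfl, h⟩
    · obtain ⟨j, rfl, h⟩ := h
      exact ⟨j, rfl, G.symm _ _ _ h⟩

/-- The index `s` of the largest element of `c` (unique when `c` is injective). -/
noncomputable def argmax {α : Type*} [LinearOrder α] {t : ℕ} (c : Fin (t + 1) → α) : Fin (t + 1) :=
  (Finite.exists_max c).choose

theorem le_argmax {α : Type*} [LinearOrder α] {t : ℕ} (c : Fin (t + 1) → α) (i : Fin (t + 1)) :
    c i ≤ c (argmax c) :=
  (Finite.exists_max c).choose_spec i

/-- The vertices of `G(c)`. -/
def FusionVertex : ℕ → Type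
  | 0 => Unit
  | t + 1 => FusionVertex t ⊕ FusionVertex t

/-- The graph `G(c)`: fusion, at the index `s` of the largest element of `c`, of the graph of
`c⁻`, which is `c` with `c_s` left out. For `t = 0` it is one vertex with label `1`, so that for
`t = 1` it consists of two vertices labelled `1`, `2` joined by an edge labelled `1`. -/
noncomputable def fusionGraph {α : Type*} [LinearOrder α] :
    (t : ℕ) → (Fin t → α) → LGraph t (FusionVertex t)
  | 0, _ => { label := fun _ => 0, link := fun _ _ _ => False, symm := fun _ _ _ h => h }
  | t + 1, c => (fusionGraph t (c ∘ (argmax c).succAbove)).fusion (argmax c)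

/-! ### Functions -/

/-- The functions `∑ d_i m^i` with `d_i ∈ ∑ ℤ c_j`, where the `c_j` and `m^i` are indeterminates;
the value at `i`, `j` is the coefficient of `c_j m^i`. -/
abbrev HHat (t : ℕ) : Type := Fin (t + 1) → Fin t → ℤ

/-- The function `r^a`, as a combination of the `m^i`, normalized by `r^{t+1} = 0` (only differences
matter): `r^a = ∑_{l ≥ a} (m^l + m^{l+1})`. -/
def rFun {t : ℕ} (a : Fin (t + 1)) : Fin (t + 1) → ℤ :=
  ∑ l : Fin t with a ≤ l.castSucc, (Pi.single l.castSucc 1 + Pi.single l.succ 1)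

/-- The defining relation `r^l - r^{l+1} = m^l + m^{l+1}`. -/
theorem rFun_sub {t : ℕ} (l : Fin t) :
    rFun l.castSucc - rFun l.succ = Pi.single l.castSucc 1 + Pi.single l.succ 1 := by
  classical
  have : (Finset.univ.filter fun k : Fin t => l.castSucc ≤ k.castSucc) =
      insert l (Finset.univ.filter fun k : Fin t => l.succ ≤ k.castSucc) := by
    ext k
    simp only [Finset.mem_filter, Finset.mem_univ, true_and, Finset.mem_insert, Fin.le_def,
      Fin.val_castSucc, Fin.val_succ, Fin.ext_iff]
    omega
  unfold rFun
  rw [this, Finset.sum_insert, add_sub_cancel_right]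
  simp [Fin.le_def]

/-- The function `c_i (r^a - r^b)`. -/
def cDiff {t : ℕ} (i : Fin t) (a b : Fin (t + 1)) : HHat t :=
  fun k j => if j = i then rFun a k - rFun b k else 0

/-- The initial function `h = - ∑ c_i m^i`, the sum being over `i = 1, …, t`. -/
def hFun (t : ℕ) : HHat t := fun k j => if k = j.castSucc then -1 else 0

namespace LGraph

variable {t : ℕ} {V : Type*}

/-- A pointed chain `v_{t+1}, …, v_1`: the vertex `v_i` has label `i`, and `(v_{i+1}, v_i)` is an
edge with label `i`. -/
def IsPointedChain (G : LGraph t V) (p : Fin (t + 1) → V) : Prop :=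
  (∀ i, G.label (p i) = i) ∧ ∀ i : Fin t, G.link i (p i.succ) (p i.castSucc)

/-- The evaluation property `f_v - f_w = c_i (r^{i_v} - r^{i_w})` for every edge `(v, w)`, `i` being
its label. -/
def IsEvaluation (G : LGraph t V) (f : V → HHat t) : Prop :=
  ∀ i v w, G.link i v w → f v - f w = cDiff i (G.label v) (G.label w)

/-- The property `P_9`. The graph has a unique pointed chain, the evaluation property and the
value `h` at the initial vertex `v_{t+1}` of that chain determine a unique map `v ↦ f_v`, and
this map separates the vertices. -/
def P9 (G : LGraph t V) : Prop :=
  ∃ p, G.IsPointedChain p ∧ (∀ p', G.IsPointedChain p' → p' = p) ∧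
    ∃ f, (G.IsEvaluation f ∧ f (p (Fin.last t)) = hFun t) ∧
      (∀ f', G.IsEvaluation f' ∧ f' (p (Fin.last t)) = hFun t → f' = f) ∧ Injective f

end LGraph

end Crystal

/-! Let `R_j` be the row of the columns of height at least `j`. The idea is to read the entries of a
tableau as labels of gaps: in row `0` the gap between `C_i` and `C_{i+1}` has the label `i`, and a
gap in a later row, being a union of gaps of the row below, inherits the label of the first (odd
row) or last (even row) of these. The relations of the tableau then hold for `c` as soon as every
gap label is `c`-minimal among all indices in its gap (`Diagram.IsMinimal.lt_of_rel`).

*Embedding.* Let `c_s` be the largest coefficient. A new column of even height, at most that of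
`C_s`, inserted directly on the left of `C_s` gives a class that does not depend on that height
(`H.mk_ins`), because the heights differ by left even dominoes. With height `0` the insertion
visibly respects the elementary operations, so it acts on classes (`H.insert`); with the largest
even height it preserves completeness, reducedness and minimality of the gap labels, the one new
gap containing only the index `s`, and a gap that grows by `s` keeping its smaller label. It
carries links to links. Reflection, which reverses the columns and adds one full row, is an
involution on classes, and turns the insertion on the left into one on the right
(`H.insertRight`). The two insertions are the two copies in the fusion, and
`H.link_insert_insertRight` provides the links between the copies: for a class with label `s`, the
columns `s`, `s + 1` of the new diagrams have the heights `r - 1`, `r` and `r`, `r` if the height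
`r` is odd, and reflection deals with even `r`. By induction this gives the map `toH`.

*Injectivity and uniqueness of edge labels.* Every column that is not strongly extremal has a gap
next to its top block, on the right for even and on the left for odd height. The label of this gap
is an invariant of the class (`Diagram.Step.topLabel_iff`), and it determines the column. A link
with label `i` passes the label `i` from the new strongly extremal column to the old one
(`H.Linkage.topLabel`), so `i` can be recovered from the two classes.

*The property `P_9`.* On the side of `G(c)` the same data is the column `z v j` with label `j`,
for every vertex `v` (`LGraph.IsMarking`). An edge `(v, w)` with label `i` only changes the `i`-th
mark, from the label of `w` to that of `v`, so that up to a constant `- r^{z v j}` is the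
coefficient of `c_j` in `f_v`. The marks separate vertices, hence so do the `f_v`, and also the
classes `toH v`; along a pointed chain all marks are forced, which makes the chain unique.
-/

namespace Crystal

namespace Diagram

variable {t : ℕ}

/-! ### Gaps and their labels -/

/-- `D.Gap j x y b`: the columns `x < y` are neighbours at level `j`, and the gap between them has
the label `b`. In row `0` the gap between `C_i` and `C_{i+1}` has the label `i`; a gap of a later
row is a union of gaps of the row below it, and takes over the label of the first of them if its
own row is odd and of the last of them if its own row is even. Thus the entry of a block is the
label of the gap on its right (odd rows) or on its left (even rows). -/
def Gap (D : Diagram t) : ℕ → Fin (t + 1) → Fin (t + 1) → Fin t → Prop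
  | 0, x, y, b => x = b.castSucc ∧ y = b.succ
  | j + 1, x, y, b => D.Neighbours (j + 1) x y ∧
      ((Even j ∧ ∃ k, D.Gap j x k b) ∨ (Odd j ∧ ∃ k, D.Gap j k y b))

variable {D D' : Diagram t} {j : ℕ} {x y x' y' : Fin (t + 1)} {b b' : Fin t}

theorem neighbours_zero : D.Neighbours 0 x y ↔ ∃ b : Fin t, x = b.castSucc ∧ y = b.succ := by
  constructor
  · rintro ⟨h, -, -, h'⟩
    refine ⟨⟨x, by omega⟩, rfl, ?_⟩
    by_contra hne
    refine absurd (h' ⟨x + 1, by omega⟩ ?_ ?_) (Nat.not_lt_zero _)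
    · simp [Fin.lt_def]
    · have : (y : ℕ) ≠ x + 1 := fun e => hne (Fin.ext (by simpa using e))
      rw [Fin.lt_def] at h ⊢
      simp only
      omega
  · rintro ⟨b, rfl, rfl⟩
    refine ⟨Fin.castSucc_lt_succ, Nat.zero_le _, Nat.zero_le _, fun l h1 h2 => ?_⟩
    rw [Fin.lt_def] at h1 h2
    simp only [Fin.val_succ, Fin.val_castSucc] at *
    omega

theorem Gap.neighbours (h : D.Gap j x y b) : D.Neighbours j x y := by
  cases j with
  | zero => exact neighbours_zero.2 ⟨b, h⟩
  | succ j => exact h.1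

theorem Neighbours.right_unique (h : D.Neighbours j x y) (h' : D.Neighbours j x y') : y = y' := by
  obtain ⟨h1, h2, h3, h4⟩ := h
  obtain ⟨h1', h2', h3', h4'⟩ := h'
  rcases lt_trichotomy y y' with q | q | q
  · have := h4' y h1 q
    omega
  · exact q
  · have := h4 y' h1' q
    omega

theorem Neighbours.left_unique (h : D.Neighbours j x y) (h' : D.Neighbours j x' y) : x = x' := by
  obtain ⟨h1, h2, h3, h4⟩ := h
  obtain ⟨h1', h2', h3', h4'⟩ := h'
  rcases lt_trichotomy x x' with q | q | q
  · have := h4 x' q h1'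
    omega
  · exact q
  · have := h4' x q h1
    omega

theorem Neighbours.le_right (h : D.Neighbours j x y) {l : Fin (t + 1)} (hl : x < l)
    (hj : j ≤ D.ht l) : y ≤ l := by
  by_contra hc
  have := h.2.2.2 l hl (not_le.1 hc)
  omega

theorem Neighbours.left_le (h : D.Neighbours j x y) {l : Fin (t + 1)} (hl : l < y)
    (hj : j ≤ D.ht l) : l ≤ x := by
  by_contra hc
  have := h.2.2.2 l (not_le.1 hc) hl
  omega

theorem exists_right_neighbour {l : Fin (t + 1)} (hx : j ≤ D.ht x) (hl : x < l)
    (hj : j ≤ D.ht l) : ∃ y, D.Neighbours j x y ∧ y ≤ l := by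
  classical
  let S : Finset (Fin (t + 1)) := Finset.univ.filter fun l => x < l ∧ j ≤ D.ht l
  have hS : l ∈ S := by simp [S, hl, hj]
  have hm : x < S.min' ⟨l, hS⟩ ∧ j ≤ D.ht (S.min' ⟨l, hS⟩) := by
    have := S.min'_mem ⟨l, hS⟩
    simpa [S] using this
  refine ⟨S.min' ⟨l, hS⟩, ⟨hm.1, hx, hm.2, fun i hi hi' => ?_⟩, S.min'_le l hS⟩
  by_contra hc
  exact absurd (S.min'_le i (by simp [S, hi, not_lt.1 hc])) (not_le.2 hi')

theorem exists_left_neighbour {l : Fin (t + 1)} (hy : j ≤ D.ht y) (hl : l < y)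
    (hj : j ≤ D.ht l) : ∃ x, D.Neighbours j x y ∧ l ≤ x := by
  classical
  let S : Finset (Fin (t + 1)) := Finset.univ.filter fun l => l < y ∧ j ≤ D.ht l
  have hS : l ∈ S := by simp [S, hl, hj]
  have hm : S.max' ⟨l, hS⟩ < y ∧ j ≤ D.ht (S.max' ⟨l, hS⟩) := by
    have := S.max'_mem ⟨l, hS⟩
    simpa [S] using this
  refine ⟨S.max' ⟨l, hS⟩, ⟨hm.1, hm.2, hy, fun i hi hi' => ?_⟩, S.le_max' l hS⟩
  by_contra hc
  exact absurd (S.le_max' i (by simp [S, hi', not_lt.1 hc])) (not_le.2 hi)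

theorem Neighbours.exists_gap (h : D.Neighbours j x y) : ∃ b, D.Gap j x y b := by
  induction j generalizing x y with
  | zero => exact neighbours_zero.1 h
  | succ j ih =>
    obtain ⟨h1, h2, h3, h4⟩ := id h
    rcases Nat.even_or_odd j with p | p
    · obtain ⟨k, hk, -⟩ := exists_right_neighbour (D := D) (j := j) (by omega) h1 (by omega)
      obtain ⟨b, hb⟩ := ih hk
      exact ⟨b, h, Or.inl ⟨p, k, hb⟩⟩
    · obtain ⟨k, hk, -⟩ := exists_left_neighbour (D := D) (j := j) (by omega) h1 (by omega)
      obtain ⟨b, hb⟩ := ih hk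
      exact ⟨b, h, Or.inr ⟨p, k, hb⟩⟩

theorem Gap.left_of_even (h : D.Gap (j + 1) x y b) (hj : Even j) : ∃ k, D.Gap j x k b := by
  rcases h.2 with ⟨-, h⟩ | ⟨q, -⟩
  · exact h
  · exact absurd hj (Nat.not_even_iff_odd.2 q)

theorem Gap.right_of_odd (h : D.Gap (j + 1) x y b) (hj : Odd j) : ∃ k, D.Gap j k y b := by
  rcases h.2 with ⟨q, -⟩ | ⟨-, h⟩
  · exact absurd q (Nat.not_even_iff_odd.2 hj)
  · exact h

/-- The label of a gap between `x` and `y` lies between `x` and `y`. -/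
theorem Gap.mem (h : D.Gap j x y b) : x ≤ b.castSucc ∧ b.succ ≤ y := by
  induction j generalizing x y with
  | zero => exact ⟨h.1.le, h.2.ge⟩
  | succ j ih =>
    obtain ⟨h1, h2, h3, -⟩ := h.neighbours
    rcases Nat.even_or_odd j with p | p
    · obtain ⟨k, hk⟩ := h.left_of_even p
      exact ⟨(ih hk).1, (ih hk).2.trans (hk.neighbours.le_right h1 (by omega))⟩
    · obtain ⟨k, hk⟩ := h.right_of_odd p
      exact ⟨(hk.neighbours.left_le h1 (by omega)).trans (ih hk).1, (ih hk).2⟩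

theorem Gap.label_unique (h : D.Gap j x y b) (h' : D.Gap j x y b') : b = b' := by
  induction j generalizing x y with
  | zero => exact Fin.castSucc_injective _ (h.1.symm.trans h'.1)
  | succ j ih =>
    rcases Nat.even_or_odd j with p | p
    · obtain ⟨k, hk⟩ := h.left_of_even p
      obtain ⟨k', hk'⟩ := h'.left_of_even p
      obtain rfl := hk.neighbours.right_unique hk'.neighbours
      exact ih hk hk'
    · obtain ⟨k, hk⟩ := h.right_of_odd p
      obtain ⟨k', hk'⟩ := h'.right_of_odd p
      obtain rfl := hk.neighbours.left_unique hk'.neighbours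
      exact ih hk hk'

/-- In each row a label occurs at most once. -/
theorem Gap.unique (h : D.Gap j x y b) (h' : D.Gap j x' y' b) : x = x' ∧ y = y' := by
  have hx : x = x' := by
    refine le_antisymm (h'.neighbours.left_le ?_ h.neighbours.2.1)
      (h.neighbours.left_le ?_ h'.neighbours.2.1)
    · exact h.mem.1.trans_lt (Fin.castSucc_lt_succ.trans_le h'.mem.2)
    · exact h'.mem.1.trans_lt (Fin.castSucc_lt_succ.trans_le h.mem.2)
  subst hx
  exact ⟨rfl, h.neighbours.right_unique h'.neighbours⟩

theorem Gap.exists_of_le (h : D.Gap j x y b) {i : ℕ} (hi : i ≤ j) : ∃ x y, D.Gap i x y b := by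
  induction j generalizing x y with
  | zero =>
    obtain rfl := Nat.le_zero.1 hi
    exact ⟨x, y, h⟩
  | succ j ih =>
    rcases hi.eq_or_lt with rfl | hi
    · exact ⟨x, y, h⟩
    rcases h.2 with ⟨-, k, hk⟩ | ⟨-, k, hk⟩ <;> exact ih hk (by omega)

/-- The gap labels up to row `j` depend only on the rows up to row `j`. -/
theorem Gap.mono (h : D.Gap j x y b)
    (H : ∀ i ≤ j, ∀ x y, D.Neighbours i x y → D'.Neighbours i x y) : D'.Gap j x y b := by
  induction j generalizing x y with
  | zero => exact h
  | succ j ih =>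
    refine ⟨H _ le_rfl _ _ h.1, ?_⟩
    rcases h.2 with ⟨p, k, hk⟩ | ⟨p, k, hk⟩
    · exact Or.inl ⟨p, k, ih hk fun i hi => H i (by omega)⟩
    · exact Or.inr ⟨p, k, ih hk fun i hi => H i (by omega)⟩

theorem Gap.congr (h : D.Gap j x y b) (H : ∀ l, ∀ i ≤ j, i ≤ D.ht l ↔ i ≤ D'.ht l) :
    D'.Gap j x y b := by
  refine h.mono fun i hi x y ⟨h1, h2, h3, h4⟩ =>
    ⟨h1, (H _ _ hi).1 h2, (H _ _ hi).1 h3, fun l hl hl' => ?_⟩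
  have := H l i hi
  have := h4 l hl hl'
  omega

/-- Two adjacent columns of height at least `j` keep the label of the gap between them. -/
theorem gap_adjacent (h : j ≤ D.ht b.castSucc) (h' : j ≤ D.ht b.succ) :
    D.Gap j b.castSucc b.succ b := by
  induction j with
  | zero => exact ⟨rfl, rfl⟩
  | succ j ih =>
    have ih := ih (by omega) (by omega)
    have h0 : D.Neighbours 0 b.castSucc b.succ := neighbours_zero.2 ⟨b, rfl, rfl⟩
    refine ⟨⟨h0.1, h, h', fun l hl hl' => absurd (h0.2.2.2 l hl hl') (Nat.not_lt_zero _)⟩, ?_⟩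
    rcases Nat.even_or_odd j with p | p
    · exact Or.inl ⟨p, _, ih⟩
    · exact Or.inr ⟨p, _, ih⟩

theorem hasEntry_iff_gap (D : Diagram t) (j : ℕ) :
    (Even j → ∀ y b, D.HasEntry j y b ↔ ∃ x, D.Gap j x y b) ∧
    (Odd j → ∀ x b, D.HasEntry j x b ↔ ∃ y, D.Gap j x y b) := by
  induction j with
  | zero =>
    refine ⟨fun _ y b => ?_, fun p => absurd p (by decide)⟩
    exact ⟨fun h => ⟨_, rfl, h⟩, fun ⟨_, _, h⟩ => h⟩
  | succ j ih =>
    constructor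
    · intro p y b
      have p : Odd j := by
        rcases Nat.even_or_odd j with q | q
        · exact absurd p (Nat.not_even_iff_odd.2 q.add_one)
        · exact q
      constructor
      · rintro ⟨h, ⟨-, ⟨l, hl, hlj⟩, k, hk, hkb⟩ | ⟨q, -⟩⟩
        · obtain ⟨y', hy'⟩ := (ih.2 p k b).1 hkb
          obtain rfl := hk.right_unique hy'.neighbours
          obtain ⟨x, hx, -⟩ := exists_left_neighbour h hl hlj
          exact ⟨x, hx, Or.inr ⟨p, k, hy'⟩⟩
        · exact absurd q (Nat.not_even_iff_odd.2 p)
      · rintro ⟨x, hx⟩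
        obtain ⟨k, hk⟩ := hx.right_of_odd p
        obtain ⟨h1, h2, h3, -⟩ := hx.neighbours
        exact ⟨h3, Or.inl ⟨p, ⟨x, h1, h2⟩, k, hk.neighbours, (ih.2 p k b).2 ⟨y, hk⟩⟩⟩
    · intro p x b
      have p : Even j := by
        rcases Nat.even_or_odd j with q | q
        · exact q
        · exact absurd q.add_one (Nat.not_even_iff_odd.2 p)
      constructor
      · rintro ⟨h, ⟨q, -⟩ | ⟨-, ⟨l, hl, hlj⟩, k, hk, hkb⟩⟩
        · exact absurd p (Nat.not_even_iff_odd.2 q)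
        · obtain ⟨x', hx'⟩ := (ih.1 p k b).1 hkb
          obtain rfl := hk.left_unique hx'.neighbours
          obtain ⟨y, hy, -⟩ := exists_right_neighbour h hl hlj
          exact ⟨y, hy, Or.inl ⟨p, k, hx'⟩⟩
      · rintro ⟨y, hy⟩
        obtain ⟨k, hk⟩ := hy.left_of_even p
        obtain ⟨h1, h2, h3, -⟩ := hy.neighbours
        exact ⟨h2, Or.inr ⟨p, ⟨y, h1, h3⟩, k, hk.neighbours, (ih.1 p k b).2 ⟨x, hk⟩⟩⟩

theorem hasEntry_even (hj : Even j) : D.HasEntry j y b ↔ ∃ x, D.Gap j x y b :=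
  (D.hasEntry_iff_gap j).1 hj y b

theorem hasEntry_odd (hj : Odd j) : D.HasEntry j x b ↔ ∃ y, D.Gap j x y b :=
  (D.hasEntry_iff_gap j).2 hj x b

/-- The label of every gap of `D` is a minimum of `c` over all indices in the gap. -/
def IsMinimal {α : Type*} [LinearOrder α] (D : Diagram t) (c : Fin t → α) : Prop :=
  ∀ j x y b, D.Gap j x y b → ∀ i : Fin t, x ≤ i.castSucc → i.succ ≤ y → c b ≤ c i

theorem IsMinimal.lt_of_rel {α : Type*} [LinearOrder α] {c : Fin t → α} (h : D.IsMinimal c)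
    (hc : Injective c) (hr : D.Rel b b') : c b < c b' := by
  obtain ⟨j, x, y, k, hj, hxy, hk, hr⟩ := hr
  obtain ⟨j, rfl⟩ : ∃ i, j = i + 1 := ⟨j - 1, by omega⟩
  simp only [Nat.add_sub_cancel] at hk hr
  rcases hr with ⟨p, hxk, hky, hn, hb, hb'⟩ | ⟨p, hxk, hky, hn, hb, hb'⟩
  · have q : Odd j := by
      rcases Nat.even_or_odd j with q | q
      · exact absurd p (Nat.not_even_iff_odd.2 q.add_one)
      · exact q
    obtain ⟨x', hb⟩ := (hasEntry_even p).1 hb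
    obtain ⟨k', hb'⟩ := (hasEntry_odd q).1 hb'
    obtain rfl := hb.neighbours.left_unique hxy
    have hle : k' ≤ y := hb'.neighbours.le_right hky (by have := hxy.2.2.1; omega)
    refine lt_of_le_of_ne (h _ _ _ _ hb _ (hxk.trans hb'.mem.1) (hb'.mem.2.trans hle)) ?_
    intro e
    obtain rfl := hc e
    obtain ⟨u, hu⟩ := hb.right_of_odd q
    obtain ⟨rfl, rfl⟩ := hu.unique hb'
    exact hn hu.neighbours
  · have q : Even j := by
      rcases Nat.even_or_odd j with q | q
      · exact q
      · exact absurd q.add_one (Nat.not_even_iff_odd.2 p)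
    obtain ⟨y', hb⟩ := (hasEntry_odd p).1 hb
    obtain ⟨k', hb'⟩ := (hasEntry_even q).1 hb'
    obtain rfl := hb.neighbours.right_unique hxy
    have hle : x ≤ k' := hb'.neighbours.left_le hxk (by have := hxy.2.1; omega)
    refine lt_of_le_of_ne (h _ _ _ _ hb _ (hle.trans hb'.mem.1) (hb'.mem.2.trans hky)) ?_
    intro e
    obtain rfl := hc e
    obtain ⟨u, hu⟩ := hb.left_of_even q
    obtain ⟨rfl, rfl⟩ := hu.unique hb'
    exact hn hu.neighbours

variable {w w' : Fin (t + 1)}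

/-! ### Reflection of diagrams -/

/-- The reflected diagram: the columns in the opposite order, on top of one more full row. The
additional row makes up for the exchange of left and right by an exchange of odd and even rows. -/
def mirror (D : Diagram t) : Diagram t where
  ht i := D.ht i.rev + 1
  left_boundary i h := by
    rcases D.right_boundary i.rev fun l hl => by
      simpa using h l.rev (Fin.rev_lt_iff.1 hl) with p | p
    · exact Or.inl p.add_one
    · exact Or.inr fun l => Nat.succ_le_succ (p _)
  right_boundary i h := by
    rcases D.left_boundary i.rev fun l hl => by
      simpa using h l.rev (Fin.lt_rev_iff.1 hl) with p | p
    · exact Or.inl p.add_one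
    · exact Or.inr fun l => Nat.succ_le_succ (p _)

theorem mirror_ht (i : Fin (t + 1)) : D.mirror.ht i = D.ht i.rev + 1 := rfl

theorem mirror_ht_rev (i : Fin (t + 1)) : D.mirror.ht i.rev = D.ht i + 1 := by
  rw [mirror_ht, Fin.rev_rev]

theorem exists_mirror_eq (h : ∀ i, 1 ≤ D.ht i) : ∃ X : Diagram t, X.mirror = D := by
  refine ⟨⟨fun i => D.ht i.rev - 1, fun i hi => ?_, fun i hi => ?_⟩, ?_⟩
  · rcases D.right_boundary i.rev fun l hl => by
      have := hi l.rev (Fin.rev_lt_iff.1 hl)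
      simp only [Fin.rev_rev] at this
      omega with ⟨a, p⟩ | p
    · exact Or.inl ⟨a, by omega⟩
    · exact Or.inr fun l => Nat.sub_le_sub_right (p _) 1
  · rcases D.left_boundary i.rev fun l hl => by
      have := hi l.rev (Fin.lt_rev_iff.1 hl)
      simp only [Fin.rev_rev] at this
      omega with ⟨a, p⟩ | p
    · have := h i.rev
      exact Or.inl ⟨a - 1, by omega⟩
    · exact Or.inr fun l => Nat.sub_le_sub_right (p _) 1
  · ext i
    have := h i
    simp only [mirror_ht, Fin.rev_rev]
    omega

theorem Neighbours.mirror (h : D.Neighbours j x y) :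
    D.mirror.Neighbours (j + 1) y.rev x.rev := by
  obtain ⟨h1, h2, h3, h4⟩ := h
  refine ⟨Fin.rev_lt_rev.2 h1, ?_, ?_, fun l hl hl' => ?_⟩
  · rw [mirror_ht_rev]
    omega
  · rw [mirror_ht_rev]
    omega
  · have := h4 l.rev (Fin.lt_rev_iff.1 hl') (Fin.rev_lt_iff.1 hl)
    rw [mirror_ht]
    omega

theorem Gap.mirror (h : D.Gap j x y b) : D.mirror.Gap (j + 1) y.rev x.rev b.rev := by
  induction j generalizing x y with
  | zero =>
    obtain ⟨rfl, rfl⟩ := h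
    rw [Fin.rev_succ, Fin.rev_castSucc]
    exact gap_adjacent (by simp [mirror_ht]) (by simp [mirror_ht])
  | succ j ih =>
    refine ⟨h.neighbours.mirror, ?_⟩
    rcases h.2 with ⟨p, k, hk⟩ | ⟨p, k, hk⟩
    · exact Or.inr ⟨p.add_one, _, ih hk⟩
    · exact Or.inl ⟨p.add_one, _, ih hk⟩

theorem neighbours_of_mirror (h : D.mirror.Neighbours (j + 1) x y) :
    D.Neighbours j y.rev x.rev := by
  obtain ⟨h1, h2, h3, h4⟩ := h
  refine ⟨Fin.rev_lt_rev.2 h1, ?_, ?_, fun l hl hl' => ?_⟩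
  · rw [mirror_ht] at h3
    omega
  · rw [mirror_ht] at h2
    omega
  · have := h4 l.rev (Fin.lt_rev_iff.1 hl') (Fin.rev_lt_iff.1 hl)
    rw [mirror_ht_rev] at this
    omega

theorem gap_of_mirror (h : D.mirror.Gap (j + 1) x y b) : D.Gap j y.rev x.rev b.rev := by
  obtain ⟨b', hb'⟩ := (neighbours_of_mirror h.neighbours).exists_gap
  have := hb'.mirror
  rw [Fin.rev_rev, Fin.rev_rev] at this
  rw [h.label_unique this, Fin.rev_rev]
  exact hb'

theorem IsMinimal.mirror {α : Type*} [LinearOrder α] {c : Fin t → α} (h : D.IsMinimal c) :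
    D.mirror.IsMinimal (c ∘ Fin.rev) := by
  rintro (_ | j) x y b hb i hx hy
  · have h1 : b ≤ i := by
      rw [hb.1, Fin.castSucc_le_castSucc_iff] at hx
      exact hx
    have h2 : i ≤ b := by
      rw [hb.2, Fin.succ_le_succ_iff] at hy
      exact hy
    rw [le_antisymm h1 h2]
  · refine h _ _ _ _ (gap_of_mirror hb) _ ?_ ?_
    · rw [← Fin.rev_succ]
      exact Fin.rev_le_rev.2 hy
    · rw [← Fin.rev_castSucc]
      exact Fin.rev_le_rev.2 hx

theorem IsMinimal.of_mirror {α : Type*} [LinearOrder α] {c : Fin t → α}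
    (h : D.mirror.IsMinimal c) : D.IsMinimal (c ∘ Fin.rev) := by
  intro j x y b hb i hx hy
  refine h _ _ _ _ hb.mirror _ ?_ ?_
  · rw [← Fin.rev_succ]
    exact Fin.rev_le_rev.2 hy
  · rw [← Fin.rev_castSucc]
    exact Fin.rev_le_rev.2 hx

theorem isStronglyExtremal_mirror {k : Fin (t + 1)} :
    D.mirror.IsStronglyExtremal k.rev ↔ D.IsStronglyExtremal k := by
  simp only [IsStronglyExtremal, mirror_ht, Fin.rev_rev, Nat.even_add_one, Nat.odd_add_one,
    Nat.not_odd_iff_even, Nat.not_even_iff_odd, Nat.add_le_add_iff_right, Nat.add_lt_add_iff_right]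
  constructor
  · rintro ⟨h1, h2, h3⟩
    refine ⟨fun l => by simpa using h1 l.rev, fun p l hl => ?_, fun p l hl => ?_⟩
    · simpa using h3 p l.rev (Fin.rev_lt_rev.2 hl)
    · simpa using h2 p l.rev (Fin.rev_lt_rev.2 hl)
  · rintro ⟨h1, h2, h3⟩
    refine ⟨fun l => h1 l.rev, fun p l hl => ?_, fun p l hl => ?_⟩
    · exact h3 p l.rev (Fin.lt_rev_iff.1 hl)
    · exact h2 p l.rev (Fin.rev_lt_iff.1 hl)

theorem CanAdjoin.mirror {k : Fin (t + 1)} (h : D.CanAdjoin k) : D.mirror.CanAdjoin k.rev := by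
  simp only [CanAdjoin, mirror_ht_rev]
  rcases h with ⟨p, i, h1, h2, h3⟩ | ⟨p, i, h1, h2, h3⟩
  · refine Or.inr ⟨p.add_one, i.rev, Fin.rev_lt_rev.2 h1, ?_, fun l hl hl' => ?_⟩
    · rw [mirror_ht_rev]
      omega
    · exact Nat.succ_le_succ (h3 l.rev (Fin.lt_rev_iff.1 hl') (Fin.rev_lt_iff.1 hl))
  · refine Or.inl ⟨p.add_one, i.rev, Fin.rev_lt_rev.2 h1, ?_, fun l hl hl' => ?_⟩
    · rw [mirror_ht_rev]
      omega
    · exact Nat.succ_le_succ (h3 l.rev (Fin.lt_rev_iff.1 hl') (Fin.rev_lt_iff.1 hl))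

theorem CanAdjoin.of_mirror {k : Fin (t + 1)} (h : D.mirror.CanAdjoin k.rev) :
    D.CanAdjoin k := by
  simp only [CanAdjoin, mirror_ht_rev, Nat.even_add_one, Nat.odd_add_one,
    Nat.not_odd_iff_even, Nat.not_even_iff_odd] at h
  rcases h with ⟨p, i, h1, h2, h3⟩ | ⟨p, i, h1, h2, h3⟩
  · refine Or.inr ⟨p, i.rev, Fin.rev_lt_iff.1 h1, ?_, fun l hl hl' => ?_⟩
    · rw [mirror_ht] at h2
      omega
    · have := h3 l.rev (Fin.rev_lt_rev.2 hl') (Fin.rev_lt_iff.1 hl)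
      rw [mirror_ht_rev] at this
      omega
  · refine Or.inl ⟨p, i.rev, Fin.lt_rev_iff.1 h1, ?_, fun l hl hl' => ?_⟩
    · rw [mirror_ht] at h2
      omega
    · have := h3 l.rev (Fin.lt_rev_iff.1 hl') (Fin.rev_lt_rev.2 hl)
      rw [mirror_ht_rev] at this
      omega

theorem complete_mirror : D.mirror.Complete ↔ D.Complete := by
  refine ⟨fun h i hi => h _ hi.mirror, fun h i hi => h i.rev (CanAdjoin.of_mirror ?_)⟩
  rwa [Fin.rev_rev]

theorem Reduced.mirror (h : D.Reduced) (h0 : ∃ i, D.ht i = 0) : D.mirror.Reduced := by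
  rintro m hm ⟨l, hl⟩
  rcases hm.eq_or_lt with rfl | hm
  · obtain ⟨i, hi⟩ := h0
    exact ⟨i.rev, by rw [mirror_ht_rev, hi]⟩
  · rw [mirror_ht] at hl
    obtain ⟨i, hi⟩ := h (m - 1) (by omega) ⟨l.rev, by omega⟩
    exact ⟨i.rev, by rw [mirror_ht_rev]; omega⟩

theorem Reduced.of_mirror (h : D.mirror.Reduced) : D.Reduced := by
  rintro m hm ⟨l, hl⟩
  obtain ⟨i, hi⟩ := h (m + 1) (by omega) ⟨l.rev, by rw [mirror_ht_rev]; omega⟩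
  exact ⟨i.rev, by rw [mirror_ht] at hi; omega⟩

theorem mirror_ht_update {k : Fin (t + 1)} {n : ℕ} (h : D'.ht = update D.ht k n) :
    D'.mirror.ht = update D.mirror.ht k.rev (n + 1) := by
  ext i
  rw [mirror_ht, h]
  by_cases e : i = k.rev
  · subst e
    simp
  · rw [update_of_ne e, update_of_ne (fun e' => e (by rw [← e', Fin.rev_rev])), mirror_ht]

theorem Step.mirror (h : Step D D') : Step D.mirror D'.mirror := by
  cases h with
  | domino i hi h =>
    refine .domino _ _ i.rev hi.mirror ?_
    rw [mirror_ht_update h, mirror_ht_rev]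
  | halfDomino i hi h =>
    refine .halfDomino _ _ i.rev (isStronglyExtremal_mirror.2 hi) ?_
    rw [mirror_ht_update h, mirror_ht_rev]
  | removeRows i hi h =>
    refine .removeRows _ _ (i + 1) (fun l e => hi l.rev (by simpa [mirror_ht] using e)) fun l => ?_
    rw [mirror_ht, mirror_ht, h]
    split_ifs <;> omega

theorem step_mirror_mirror (D : Diagram t) : Step D.mirror.mirror D := by
  refine .removeRows _ _ 0 (fun l e => ?_) fun l => ?_
  · simp only [mirror_ht] at e
    omega
  · simp [mirror_ht]

/-! ### The labels of the columns -/

/-- `D.TopLabel w b`: the gap next to the top block of the column `w`, on the right of it for even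
and on the left of it for odd height, has the label `b`. All columns but the strongly extremal one
have such a label, and different columns have different labels. -/
def TopLabel (D : Diagram t) (w : Fin (t + 1)) (b : Fin t) : Prop :=
  (Even (D.ht w) ∧ ∃ y, D.Gap (D.ht w) w y b) ∨ (Odd (D.ht w) ∧ ∃ x, D.Gap (D.ht w) x w b)

theorem TopLabel.even (h : D.TopLabel w b) (p : Even (D.ht w)) : ∃ y, D.Gap (D.ht w) w y b := by
  rcases h with ⟨-, h⟩ | ⟨q, -⟩
  · exact h
  · exact absurd p (Nat.not_even_iff_odd.2 q)

theorem TopLabel.odd (h : D.TopLabel w b) (p : Odd (D.ht w)) : ∃ x, D.Gap (D.ht w) x w b := by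
  rcases h with ⟨q, -⟩ | ⟨-, h⟩
  · exact absurd q (Nat.not_even_iff_odd.2 p)
  · exact h

theorem TopLabel.label_unique (h : D.TopLabel w b) (h' : D.TopLabel w b') : b = b' := by
  rcases Nat.even_or_odd (D.ht w) with p | p
  · obtain ⟨y, hy⟩ := h.even p
    obtain ⟨y', hy'⟩ := h'.even p
    obtain rfl := hy.neighbours.right_unique hy'.neighbours
    exact hy.label_unique hy'
  · obtain ⟨y, hy⟩ := h.odd p
    obtain ⟨y', hy'⟩ := h'.odd p
    obtain rfl := hy.neighbours.left_unique hy'.neighbours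
    exact hy.label_unique hy'

/-- The label of a column does not occur above the top of that column. -/
theorem TopLabel.le_of_gap (h : D.TopLabel w b) (hg : D.Gap j x y b) : j ≤ D.ht w := by
  by_contra hc
  obtain ⟨x, y, hg⟩ := hg.exists_of_le (i := D.ht w + 1) (by omega)
  have hn := hg.neighbours
  rcases Nat.even_or_odd (D.ht w) with p | p
  · obtain ⟨k, hk⟩ := hg.left_of_even p
    obtain ⟨y', hy'⟩ := h.even p
    obtain ⟨rfl, -⟩ := hk.unique hy'
    have := hn.2.1
    omega
  · obtain ⟨k, hk⟩ := hg.right_of_odd p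
    obtain ⟨x', hx'⟩ := h.odd p
    obtain ⟨-, rfl⟩ := hk.unique hx'
    have := hn.2.2.1
    omega

theorem TopLabel.exists_gap (h : D.TopLabel w b) : ∃ x y, D.Gap (D.ht w) x y b := by
  rcases h with ⟨-, y, h⟩ | ⟨-, x, h⟩
  · exact ⟨_, _, h⟩
  · exact ⟨_, _, h⟩

theorem TopLabel.col_unique (h : D.TopLabel w b) (h' : D.TopLabel w' b) : w = w' := by
  obtain ⟨x, y, hg⟩ := h.exists_gap
  obtain ⟨x', y', hg'⟩ := h'.exists_gap
  have e : D.ht w = D.ht w' := le_antisymm (h'.le_of_gap hg) (h.le_of_gap hg')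
  rcases Nat.even_or_odd (D.ht w) with p | p
  · obtain ⟨y, hy⟩ := h.even p
    obtain ⟨y', hy'⟩ := h'.even (e ▸ p)
    rw [← e] at hy'
    exact (hy.unique hy').1
  · obtain ⟨y, hy⟩ := h.odd p
    obtain ⟨y', hy'⟩ := h'.odd (e ▸ p)
    rw [← e] at hy'
    exact (hy.unique hy').2

theorem IsStronglyExtremal.not_topLabel (h : D.IsStronglyExtremal w) : ¬ D.TopLabel w b := by
  rintro (⟨p, y, hy⟩ | ⟨p, y, hy⟩)
  · obtain ⟨h1, -, h2, -⟩ := hy.neighbours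
    have := h.2.2 p y h1
    omega
  · obtain ⟨h1, h2, -, -⟩ := hy.neighbours
    have := h.2.1 p y h1
    omega

theorem exists_topLabel (h : ¬ D.IsStronglyExtremal w) : ∃ b, D.TopLabel w b := by
  rcases Nat.even_or_odd (D.ht w) with p | p
  · suffices ∃ l, w < l ∧ D.ht w ≤ D.ht l by
      obtain ⟨l, hl, hl'⟩ := this
      obtain ⟨y, hy, -⟩ := exists_right_neighbour le_rfl hl hl'
      obtain ⟨b, hb⟩ := hy.exists_gap
      exact ⟨b, Or.inl ⟨p, y, hb⟩⟩
    by_contra! hc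
    rcases D.right_boundary w hc with q | q
    · exact Nat.not_even_iff_odd.2 q p
    · exact h ⟨q, fun q => absurd p (Nat.not_even_iff_odd.2 q), fun _ => hc⟩
  · suffices ∃ l, l < w ∧ D.ht w ≤ D.ht l by
      obtain ⟨l, hl, hl'⟩ := this
      obtain ⟨y, hy, -⟩ := exists_left_neighbour le_rfl hl hl'
      obtain ⟨b, hb⟩ := hy.exists_gap
      exact ⟨b, Or.inr ⟨p, y, hb⟩⟩
    by_contra! hc
    rcases D.left_boundary w hc with q | q
    · exact Nat.not_even_iff_odd.2 p q
    · exact h ⟨q, fun _ => hc, fun q => absurd q (Nat.not_even_iff_odd.2 p)⟩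

theorem TopLabel.mirror (h : D.TopLabel w b) : D.mirror.TopLabel w.rev b.rev := by
  rw [TopLabel, mirror_ht_rev]
  rcases h with ⟨p, y, h⟩ | ⟨p, y, h⟩
  · exact Or.inr ⟨p.add_one, _, h.mirror⟩
  · exact Or.inl ⟨p.add_one, _, h.mirror⟩

theorem TopLabel.of_mirror (h : D.mirror.TopLabel w.rev b.rev) : D.TopLabel w b := by
  rw [TopLabel, mirror_ht_rev, Nat.even_add_one, Nat.odd_add_one, Nat.not_odd_iff_even,
    Nat.not_even_iff_odd] at h
  rcases h with ⟨p, y, h⟩ | ⟨p, y, h⟩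
  · have := gap_of_mirror h
    rw [Fin.rev_rev, Fin.rev_rev] at this
    exact Or.inr ⟨p, _, this⟩
  · have := gap_of_mirror h
    rw [Fin.rev_rev, Fin.rev_rev] at this
    exact Or.inl ⟨p, _, this⟩

/-! ### Invariance of the column labels -/

/-- Let a left even domino be put on the column `i`, which becomes the left neighbour of `k` at two
levels. The labels of the gaps do not change; only the gaps that end at `k` at these two levels
now end at `i`. -/
theorem Gap.domino {i k : Fin (t + 1)} (hp : Even (D.ht i)) (hik : i < k)
    (hk : D.ht i + 2 ≤ D.ht k) (hl : ∀ l, i < l → l < k → D.ht l ≤ D.ht i)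
    (h : D'.ht = update D.ht i (D.ht i + 2)) (hg : D.Gap j x y b) :
    D'.Gap j x (if D.ht i < j ∧ j ≤ D.ht i + 2 ∧ y = k then i else y) b := by
  have ei : D'.ht i = D.ht i + 2 := by rw [h, update_self]
  have el : ∀ l, l ≠ i → D'.ht l = D.ht l := fun l hl => by rw [h, update_of_ne hl]
  have hle : ∀ l, D.ht l ≤ D'.ht l := fun l => by
    by_cases e : l = i
    · rw [e]
      omega
    · rw [el l e]
  have nb : ∀ j x y, D.Neighbours j x y →
      D'.Neighbours j x (if D.ht i < j ∧ j ≤ D.ht i + 2 ∧ y = k then i else y) := by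
    rintro j x y ⟨h1, h2, h3, h4⟩
    split_ifs with c
    · obtain ⟨c1, c2, rfl⟩ := c
      have hxi : x < i := by
        rcases lt_trichotomy x i with q | rfl | q
        · exact q
        · omega
        · have := hl x q h1
          omega
      refine ⟨hxi, h2.trans (hle x), by omega, fun l a b => ?_⟩
      rw [el l b.ne]
      exact h4 l a (b.trans hik)
    · refine ⟨h1, h2.trans (hle x), h3.trans (hle y), fun l a b => ?_⟩
      by_cases e : l = i
      · subst e
        have q := h4 l a b
        rw [ei]
        by_contra hc
        refine c ⟨q, by omega, ?_⟩
        rcases lt_trichotomy y k with r | r | r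
        · have := hl y b r
          omega
        · exact r
        · have := h4 k (a.trans hik) r
          omega
      · rw [el l e]
        exact h4 l a b
  induction j generalizing x y with
  | zero =>
    rw [if_neg fun c => Nat.not_lt_zero _ c.1]
    exact hg
  | succ j ih =>
    refine ⟨nb _ _ _ hg.1, ?_⟩
    rcases hg.2 with ⟨p, z, hz⟩ | ⟨p, z, hz⟩
    · exact Or.inl ⟨p, _, ih hz⟩
    · refine Or.inr ⟨p, z, ?_⟩
      -- As `j` is odd and the height of `i` even, the rows `j` and `j + 1` are either both changed
      -- or both unchanged.
      have e : (D.ht i < j + 1 ∧ j + 1 ≤ D.ht i + 2 ∧ y = k) ↔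
          (D.ht i < j ∧ j ≤ D.ht i + 2 ∧ y = k) := by
        obtain ⟨u, hu⟩ := hp
        obtain ⟨v, hv⟩ := p
        constructor <;> rintro ⟨a, b, c⟩ <;> exact ⟨by omega, by omega, c⟩
      rw [if_congr e rfl rfl]
      exact ih hz

theorem TopLabel.domino {i k : Fin (t + 1)} (hp : Even (D.ht i)) (hik : i < k)
    (hk : D.ht i + 2 ≤ D.ht k) (hl : ∀ l, i < l → l < k → D.ht l ≤ D.ht i)
    (h : D'.ht = update D.ht i (D.ht i + 2)) (hw : D.TopLabel w b) : D'.TopLabel w b := by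
  have ei : D'.ht i = D.ht i + 2 := by rw [h, update_self]
  have el : ∀ l, l ≠ i → D'.ht l = D.ht l := fun l hl => by rw [h, update_of_ne hl]
  have G : ∀ {j x y b}, D.Gap j x y b →
      D'.Gap j x (if D.ht i < j ∧ j ≤ D.ht i + 2 ∧ y = k then i else y) b :=
    fun hg => hg.domino hp hik hk hl h
  by_cases e : w = i
  · subst e
    obtain ⟨y, hy⟩ := hw.even hp
    refine Or.inl ⟨by rw [ei]; exact hp.add even_two, k, ?_⟩
    rw [ei]
    have nb : ∀ j, D.ht w < j → j ≤ D.ht w + 2 → D'.Neighbours j w k := fun j h1 h2 =>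
      ⟨hik, by omega, by rw [el k hik.ne']; omega, fun l a b => by
        rw [el l a.ne']
        have := hl l a b
        omega⟩
    exact ⟨nb _ (by omega) le_rfl, Or.inr ⟨hp.add_one, w, nb _ (by omega) (by omega),
      Or.inl ⟨hp, _, G hy⟩⟩⟩
  · rw [TopLabel, el w e]
    rcases hw with ⟨p, y, hy⟩ | ⟨p, x, hx⟩
    · exact Or.inl ⟨p, _, G hy⟩
    · refine Or.inr ⟨p, x, ?_⟩
      have := G hx
      rwa [if_neg] at this
      rintro ⟨c1, c2, rfl⟩
      obtain ⟨u, hu⟩ := hp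
      obtain ⟨v, hv⟩ := p
      omega

theorem Gap.of_two_rows {i : ℕ} (hi : ∀ l, D.ht l ≠ i + 1) (h : D.Gap (i + 2) x y b) :
    (Even i → ∃ z, D.Gap i x z b) ∧ (Odd i → ∃ z, D.Gap i z y b) := by
  obtain ⟨h1, h2, h3, h4⟩ := h.neighbours
  constructor
  · intro p
    obtain ⟨k, hk⟩ := h.right_of_odd p.add_one
    have hkx : x ≤ k := hk.neighbours.left_le h1 (by omega)
    have hxk : k ≤ x := by
      by_contra hc
      have := h4 k (not_le.1 hc) hk.neighbours.1
      have := hk.neighbours.2.1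
      have := hi k
      omega
    obtain rfl := le_antisymm hkx hxk
    exact hk.left_of_even p
  · intro p
    obtain ⟨k, hk⟩ := h.left_of_even p.add_one
    have hkx : k ≤ y := hk.neighbours.le_right h1 (by omega)
    have hxk : y ≤ k := by
      by_contra hc
      have := h4 k hk.neighbours.1 (not_le.1 hc)
      have := hk.neighbours.2.2.1
      have := hi k
      omega
    obtain rfl := le_antisymm hkx hxk
    exact hk.right_of_odd p

theorem Gap.removeRows_of_le {i : ℕ} (hi : ∀ l, D.ht l ≠ i + 1)
    (h : ∀ l, D'.ht l = if i + 2 ≤ D.ht l then D.ht l - 2 else D.ht l) (hg : D.Gap j x y b)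
    (hj : j ≤ i) : D'.Gap j x y b := by
  refine hg.congr fun l m hm => ?_
  have := hi l
  rw [h l]
  split_ifs <;> omega

theorem Gap.removeRows_of_lt {i : ℕ} (hi : ∀ l, D.ht l ≠ i + 1)
    (h : ∀ l, D'.ht l = if i + 2 ≤ D.ht l then D.ht l - 2 else D.ht l)
    (hg : D.Gap (j + 2) x y b) (hj : i < j) : D'.Gap j x y b := by
  have hh : ∀ m, i < m → ∀ l, m ≤ D'.ht l ↔ m + 2 ≤ D.ht l := fun m hm l => by
    have := hi l
    rw [h l]
    split_ifs <;> omega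
  have nb : ∀ m, i < m → ∀ x y, D.Neighbours (m + 2) x y → D'.Neighbours m x y := by
    rintro m hm x y ⟨h1, h2, h3, h4⟩
    refine ⟨h1, (hh m hm x).2 h2, (hh m hm y).2 h3, fun l a b => ?_⟩
    have := h4 l a b
    have := hh m hm l
    omega
  induction j generalizing x y with
  | zero => omega
  | succ j ih =>
    refine ⟨nb _ hj _ _ hg.1, ?_⟩
    have par : Even (j + 2) ↔ Even j := by simp [Nat.even_add]
    have par' : Odd (j + 2) ↔ Odd j := by simp [Nat.odd_add]
    rcases hg.2 with ⟨p, z, hz⟩ | ⟨p, z, hz⟩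
    · refine Or.inl ⟨par.1 p, ?_⟩
      rcases (Nat.lt_succ_iff.1 hj).eq_or_lt with rfl | hj'
      · obtain ⟨z', hz'⟩ := (hz.of_two_rows hi).1 (par.1 p)
        exact ⟨z', hz'.removeRows_of_le hi h le_rfl⟩
      · exact ⟨z, ih hz hj'⟩
    · refine Or.inr ⟨par'.1 p, ?_⟩
      rcases (Nat.lt_succ_iff.1 hj).eq_or_lt with rfl | hj'
      · obtain ⟨z', hz'⟩ := (hz.of_two_rows hi).2 (par'.1 p)
        exact ⟨z', hz'.removeRows_of_le hi h le_rfl⟩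
      · exact ⟨z, ih hz hj'⟩

theorem TopLabel.removeRows {i : ℕ} (hi : ∀ l, D.ht l ≠ i + 1)
    (h : ∀ l, D'.ht l = if i + 2 ≤ D.ht l then D.ht l - 2 else D.ht l) (hw : D.TopLabel w b) :
    D'.TopLabel w b := by
  rw [TopLabel, h w]
  split_ifs with c
  · obtain ⟨r, hr⟩ : ∃ r, D.ht w = r + 2 := ⟨D.ht w - 2, by omega⟩
    rw [TopLabel, hr] at hw
    have par : Even (r + 2) ↔ Even r := by simp [Nat.even_add]
    have par' : Odd (r + 2) ↔ Odd r := by simp [Nat.odd_add]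
    rw [hr, Nat.add_sub_cancel]
    rw [par, par'] at hw
    have hir : i ≤ r := by omega
    rcases hir.eq_or_lt with rfl | hir
    · rcases hw with ⟨p, y, hy⟩ | ⟨p, y, hy⟩
      · obtain ⟨z, hz⟩ := (hy.of_two_rows hi).1 p
        exact Or.inl ⟨p, z, hz.removeRows_of_le hi h le_rfl⟩
      · obtain ⟨z, hz⟩ := (hy.of_two_rows hi).2 p
        exact Or.inr ⟨p, z, hz.removeRows_of_le hi h le_rfl⟩
    · rcases hw with ⟨p, y, hy⟩ | ⟨p, y, hy⟩
      · exact Or.inl ⟨p, y, hy.removeRows_of_lt hi h hir⟩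
      · exact Or.inr ⟨p, y, hy.removeRows_of_lt hi h hir⟩
  · have hwi : D.ht w ≤ i := by
      have := hi w
      omega
    rcases hw with ⟨p, y, hy⟩ | ⟨p, y, hy⟩
    · exact Or.inl ⟨p, y, hy.removeRows_of_le hi h hwi⟩
    · exact Or.inr ⟨p, y, hy.removeRows_of_le hi h hwi⟩

theorem TopLabel.halfDomino {i : Fin (t + 1)} (hi : D.IsStronglyExtremal i)
    (h : D'.ht = update D.ht i (D.ht i + 1)) (hw : D.TopLabel w b) : D'.TopLabel w b := by
  have ei : D'.ht i = D.ht i + 1 := by rw [h, update_self]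
  have el : ∀ l, l ≠ i → D'.ht l = D.ht l := fun l hl => by rw [h, update_of_ne hl]
  have G : ∀ {j x y b}, D.Gap j x y b → D'.Gap j x y b := fun hg =>
    hg.congr fun l m hm => by
      by_cases e : l = i
      · subst e
        have := hg.neighbours.2.1.trans (hi.1 _)
        rw [ei]
        omega
      · rw [el l e]
  have hne : w ≠ i := by
    rintro rfl
    exact hi.not_topLabel hw
  rw [TopLabel, el w hne]
  rcases hw with ⟨p, y, hy⟩ | ⟨p, y, hy⟩
  · exact Or.inl ⟨p, y, G hy⟩
  · exact Or.inr ⟨p, y, G hy⟩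

theorem Step.topLabel (s : Step D D') (hw : D.TopLabel w b) : D'.TopLabel w b := by
  cases s with
  | domino i hi h =>
    rcases hi with ⟨p, k, hik, hk, hl⟩ | ⟨p, k, hik, hk, hl⟩
    · exact hw.domino p hik hk hl h
    · refine TopLabel.of_mirror (hw.mirror.domino (i := i.rev) (k := k.rev) ?_
        (Fin.rev_lt_rev.2 hik) ?_ (fun l a b => ?_) ?_)
      · rw [mirror_ht_rev]
        exact p.add_one
      · rw [mirror_ht_rev, mirror_ht_rev]
        omega
      · rw [mirror_ht_rev, mirror_ht]
        exact Nat.succ_le_succ (hl l.rev (Fin.lt_rev_iff.1 b) (Fin.rev_lt_iff.1 a))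
      · rw [mirror_ht_update h, mirror_ht_rev]
  | halfDomino i hi h => exact hw.halfDomino hi h
  | removeRows i hi h => exact hw.removeRows hi h

theorem Step.topLabel_iff (s : Step D D') : D.TopLabel w b ↔ D'.TopLabel w b := by
  refine ⟨s.topLabel, fun hw => ?_⟩
  obtain ⟨b', hb'⟩ := exists_topLabel (D := D) fun hs => (s.stronglyExtremal hs).not_topLabel hw
  rw [hw.label_unique (s.topLabel hb')]
  exact hb'

end Diagram

namespace H

open Diagram

variable {t : ℕ} {D D' : Diagram t} {x y : H t} {w w' : Fin (t + 1)} {b b' : Fin t}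

theorem mk_eq_of_step (s : Step D D') : mk D = mk D' := Quot.sound s

/-- The label of a column depends only on the class of the diagram. -/
def TopLabel (x : H t) (w : Fin (t + 1)) (b : Fin t) : Prop :=
  Quot.lift (fun D : Diagram t => D.TopLabel w b) (fun _ _ s => propext s.topLabel_iff) x

theorem topLabel_mk : (mk D).TopLabel w b ↔ D.TopLabel w b := Iff.rfl

theorem TopLabel.label_unique (h : x.TopLabel w b) (h' : x.TopLabel w b') : b = b' := by
  induction x using Quot.ind
  exact Diagram.TopLabel.label_unique h h'

theorem TopLabel.col_unique (h : x.TopLabel w b) (h' : x.TopLabel w' b) : w = w' := by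
  induction x using Quot.ind
  exact Diagram.TopLabel.col_unique h h'

theorem label_eq_of_isStronglyExtremal (h : D.IsStronglyExtremal w) : (mk D).label = w :=
  D.strongCol_spec.unique h

theorem isStronglyExtremal_label (D : Diagram t) : D.IsStronglyExtremal (mk D).label :=
  D.strongCol_spec

/-- A link moves the label `i` of the new strongly extremal column to the old one. -/
theorem Linkage.topLabel {i : Fin t} (h : Linkage i x y) :
    x.TopLabel y.label i ∧ y.TopLabel x.label i := by
  obtain ⟨D, D', k, rfl, rfl, -, -, hD', hk, hk', he⟩ := h
  rw [label_eq_of_isStronglyExtremal hk', topLabel_mk, topLabel_mk]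
  have ho := isStronglyExtremal_label D
  revert ho
  generalize (mk D).label = o
  intro ho
  have hok : o ≠ k := by
    rintro rfl
    exact hk ho
  have ek : D'.ht k = D.ht k + 1 := by rw [hD', update_self]
  have el : ∀ l, l ≠ k → D'.ht l = D.ht l := fun l hl => by rw [hD', update_of_ne hl]
  have hle : D.ht o ≤ D.ht k + 1 := by
    rw [← ek, ← el o hok]
    exact hk'.1 o
  -- The rows of `D` and `D'` up to the height of `k` in `D` are the same.
  have low : ∀ {u v b}, D'.Gap (D.ht k) u v b → D.Gap (D.ht k) u v b := fun hg =>
    hg.congr fun l m hm => by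
      by_cases e : l = k
      · subst e
        rw [ek]
        omega
      · rw [el l e]
  rcases Nat.even_or_odd (D.ht k) with p | p
  · obtain ⟨v, hv⟩ := (hasEntry_odd p.add_one).1 he
    obtain ⟨z, hz⟩ := hv.left_of_even p
    refine ⟨Or.inl ⟨p, z, low hz⟩, ?_⟩
    obtain ⟨h1, -, h2, -⟩ := hv.neighbours
    rw [el v h1.ne'] at h2
    have e : D.ht o = D.ht k + 1 := le_antisymm hle (h2.trans (ho.1 v))
    have hov : o ≤ v := by
      by_contra hc
      have := ho.2.1 (e ▸ p.add_one) v (not_le.1 hc)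
      omega
    have hko : k < o := by
      refine lt_of_le_of_ne ?_ hok.symm
      by_contra hc
      have := hk'.2.1 (ek ▸ p.add_one) o (not_le.1 hc)
      rw [ek, el o hok] at this
      omega
    have hvo : v ≤ o := hv.neighbours.le_right hko (by rw [el o hok]; omega)
    obtain rfl := le_antisymm hov hvo
    have e' : D'.ht o = D.ht k + 1 := by rw [el o hok, e]
    exact Or.inr ⟨e' ▸ p.add_one, k, e' ▸ hv⟩
  · obtain ⟨v, hv⟩ := (hasEntry_even p.add_one).1 he
    obtain ⟨z, hz⟩ := hv.right_of_odd p
    refine ⟨Or.inr ⟨p, z, low hz⟩, ?_⟩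
    obtain ⟨h1, h2, -, -⟩ := hv.neighbours
    rw [el v h1.ne] at h2
    have e : D.ht o = D.ht k + 1 := le_antisymm hle (h2.trans (ho.1 v))
    have hov : v ≤ o := by
      by_contra hc
      have := ho.2.2 (e ▸ p.add_one) v (not_le.1 hc)
      omega
    have hko : o < k := by
      refine lt_of_le_of_ne ?_ hok
      by_contra hc
      have := hk'.2.2 (ek ▸ p.add_one) o (not_le.1 hc)
      rw [ek, el o hok] at this
      omega
    have hvo : o ≤ v := hv.neighbours.left_le hko (by rw [el o hok]; omega)
    obtain rfl := le_antisymm hvo hov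
    have e' : D'.ht o = D.ht k + 1 := by rw [el o hok, e]
    exact Or.inl ⟨e' ▸ p.add_one, k, e' ▸ hv⟩

theorem link_topLabel {i : Fin t} (h : (linkGraph t).link i x y) : x.TopLabel y.label i := by
  rcases h with h | h
  · exact h.topLabel.1
  · exact h.topLabel.2

/-! ### Reflection of classes -/

/-- The class of the reflected diagrams. -/
def mirror : H t → H t :=
  Quot.lift (fun D => mk D.mirror) fun _ _ s => mk_eq_of_step s.mirror

theorem mirror_mk (D : Diagram t) : (mk D).mirror = mk D.mirror := rfl

theorem mirror_mk_mirror (D : Diagram t) : (mk D.mirror).mirror = mk D :=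
  mk_eq_of_step D.step_mirror_mirror

theorem mirror_mirror (x : H t) : x.mirror.mirror = x := by
  induction x using Quot.ind
  exact mirror_mk_mirror _

theorem label_mirror (x : H t) : x.mirror.label = x.label.rev := by
  induction x using Quot.ind with
  | mk D =>
    exact label_eq_of_isStronglyExtremal
      (isStronglyExtremal_mirror.2 (isStronglyExtremal_label D))

theorem TopLabel.mirror (h : x.TopLabel w b) : x.mirror.TopLabel w.rev b.rev := by
  induction x using Quot.ind
  exact Diagram.TopLabel.mirror h

theorem Linkage.mirror {i : Fin t} (h : Linkage i x y) : Linkage i.rev x.mirror y.mirror := by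
  obtain ⟨D, D', k, rfl, rfl, hc, hr, hD', hk, hk', he⟩ := h
  by_cases h0 : ∃ l, D.ht l = 0
  · refine ⟨D.mirror, D'.mirror, k.rev, rfl, rfl, complete_mirror.2 hc, hr.mirror h0, ?_,
      fun h => hk (isStronglyExtremal_mirror.1 h), isStronglyExtremal_mirror.2 hk', ?_⟩
    · rw [mirror_ht_update hD', mirror_ht_rev]
    · rw [mirror_ht_rev]
      rcases Nat.even_or_odd (D.ht k + 1) with p | p
      · obtain ⟨v, hv⟩ := (hasEntry_even p).1 he
        exact (hasEntry_odd p.add_one).2 ⟨_, hv.mirror⟩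
      · obtain ⟨v, hv⟩ := (hasEntry_odd p).1 he
        exact (hasEntry_even p.add_one).2 ⟨_, hv.mirror⟩
  · have hD : ∀ l, 1 ≤ D.ht l := fun l => Nat.one_le_iff_ne_zero.2 fun e => h0 ⟨l, e⟩
    obtain ⟨X, rfl⟩ := exists_mirror_eq hD
    obtain ⟨Y, rfl⟩ := exists_mirror_eq (D := D') fun l => by
      rw [hD']
      by_cases e : l = k
      · subst e
        simp
      · rw [update_of_ne e]
        exact hD l
    have hX : X.mirror.ht k = X.ht k.rev + 1 := rfl
    rw [← Fin.rev_rev k] at hk hk'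
    refine ⟨X, Y, k.rev, (mirror_mk_mirror X).symm, (mirror_mk_mirror Y).symm,
      complete_mirror.1 hc, hr.of_mirror, ?_, fun h => hk (isStronglyExtremal_mirror.2 h),
      isStronglyExtremal_mirror.1 hk', ?_⟩
    · ext l
      have := congrFun hD' l.rev
      by_cases e : l = k.rev
      · subst e
        rw [Fin.rev_rev, update_self, mirror_ht, mirror_ht] at this
        rw [update_self]
        omega
      · have e' : l.rev ≠ k := fun h => e (by rw [← h, Fin.rev_rev])
        rw [update_of_ne e', mirror_ht_rev, mirror_ht_rev] at this
        rw [update_of_ne e]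
        omega
    · rw [hX] at he
      rcases Nat.even_or_odd (X.ht k.rev + 1) with p | p
      · obtain ⟨v, hv⟩ := (hasEntry_odd p.add_one).1 he
        exact (hasEntry_even p).2 ⟨_, gap_of_mirror hv⟩
      · obtain ⟨v, hv⟩ := (hasEntry_even p.add_one).1 he
        exact (hasEntry_odd p).2 ⟨_, gap_of_mirror hv⟩

theorem link_mirror {i : Fin t} (h : (linkGraph t).link i x y) :
    (linkGraph t).link i.rev x.mirror y.mirror :=
  h.imp Linkage.mirror Linkage.mirror

/-- The class `x` contains a complete reduced diagram whose gap labels are minimal for `c`. -/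
def IsMinimal {α : Type*} [LinearOrder α] (c : Fin t → α) (x : H t) : Prop :=
  ∃ D : Diagram t, mk D = x ∧ D.Complete ∧ D.Reduced ∧ D.IsMinimal c

variable {α : Type*} [LinearOrder α] {c : Fin t → α}

theorem IsMinimal.mem_hSet (h : IsMinimal c x) (hc : Injective c) : x ∈ HSet c := by
  obtain ⟨D, hD, h1, -, h2⟩ := h
  exact ⟨D, hD, h1, fun b b' => h2.lt_of_rel hc⟩

/-- The reflection of a class has a representative of the same kind: two full rows are to be removed
from `D.mirror` unless `D` has an empty column. -/
theorem exists_reduced_mirror (hc : D.Complete) (hr : D.Reduced) (hm : D.IsMinimal c) :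
    ∃ X : Diagram t, mk X = (mk D).mirror ∧ X.Complete ∧ X.Reduced ∧
      X.IsMinimal (c ∘ Fin.rev) ∧ ∀ i, Even (D.ht i) → Odd (X.ht i.rev) := by
  by_cases h0 : ∃ l, D.ht l = 0
  · exact ⟨D.mirror, rfl, complete_mirror.2 hc, hr.mirror h0, hm.mirror,
      fun i p => by rw [mirror_ht_rev]; exact p.add_one⟩
  · obtain ⟨X, rfl⟩ := exists_mirror_eq (D := D) fun l =>
      Nat.one_le_iff_ne_zero.2 fun e => h0 ⟨l, e⟩
    exact ⟨X, (mirror_mk_mirror X).symm, complete_mirror.1 hc, hr.of_mirror, hm.of_mirror,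
      fun i p => by simpa [mirror_ht, Nat.even_add_one] using p⟩

theorem IsMinimal.mirror (h : IsMinimal c x) : IsMinimal (c ∘ Fin.rev) x.mirror := by
  obtain ⟨D, rfl, hc, hr, hm⟩ := h
  obtain ⟨X, hX, h1, h2, h3, -⟩ := exists_reduced_mirror hc hr hm
  exact ⟨X, hX, h1, h2, h3⟩

end H

/-! ### Insertion of a column -/

theorem castSucc_lt_succAbove {t : ℕ} {s w : Fin (t + 1)} :
    s.castSucc < s.castSucc.succAbove w ↔ s ≤ w := by
  rw [Fin.lt_succAbove_iff_le_castSucc, Fin.castSucc_le_castSucc_iff]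

theorem succAbove_lt_castSucc {t : ℕ} {s w : Fin (t + 1)} :
    s.castSucc.succAbove w < s.castSucc ↔ w < s := by
  rw [Fin.succAbove_lt_iff_castSucc_lt, Fin.castSucc_lt_castSucc_iff]

theorem castSucc_succAbove_self {t : ℕ} (s : Fin (t + 1)) : s.castSucc.succAbove s = s.succ := by
  rw [Fin.succAbove_of_le_castSucc _ _ le_rfl]

theorem succ_succAbove_self {t : ℕ} (s : Fin (t + 1)) : s.succ.succAbove s = s.castSucc := by
  rw [Fin.succAbove_of_castSucc_lt _ _ Fin.castSucc_lt_succ]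

theorem castSucc_succAbove_of_ne {t : ℕ} {s w : Fin (t + 1)} (h : w ≠ s) :
    s.castSucc.succAbove w = s.succ.succAbove w := by
  rcases lt_or_gt_of_ne h with q | q
  · rw [Fin.succAbove_of_castSucc_lt _ _ (Fin.castSucc_lt_castSucc_iff.2 q),
      Fin.succAbove_of_castSucc_lt _ _ ((Fin.castSucc_lt_castSucc_iff.2 q).trans
        Fin.castSucc_lt_succ)]
  · rw [Fin.succAbove_of_le_castSucc _ _ (Fin.castSucc_le_castSucc_iff.2 q.le),
      Fin.succAbove_of_le_castSucc _ _ (Fin.succ_le_castSucc_iff.2 q)]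

theorem castSucc_succAbove_castSucc {t : ℕ} (s : Fin (t + 1)) (b : Fin t) :
    s.castSucc.succAbove b.castSucc = (s.succAbove b).castSucc := by
  rcases lt_or_ge b.castSucc s with q | q
  · rw [Fin.succAbove_of_castSucc_lt _ _ (Fin.castSucc_lt_castSucc_iff.2 q),
      Fin.succAbove_of_castSucc_lt _ _ q]
  · rw [Fin.succAbove_of_le_castSucc _ _ (Fin.castSucc_le_castSucc_iff.2 q),
      Fin.succAbove_of_le_castSucc _ _ q, Fin.succ_castSucc]

theorem castSucc_succAbove_succ {t : ℕ} (s : Fin (t + 1)) (b : Fin t) (h : b.succ ≠ s) :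
    s.castSucc.succAbove b.succ = (s.succAbove b).succ := by
  rw [castSucc_succAbove_of_ne h, Fin.succ_succAbove_succ]

namespace Diagram

variable {t : ℕ} {D D' : Diagram t} {j : ℕ} {x y x' y' w w' : Fin (t + 1)} {b b' : Fin t}

/-- The diagram `D` with a new column, of even height `e`, directly on the left of the column `s`,
which is at least as high. -/
def ins (D : Diagram t) (s : Fin (t + 1)) (e : ℕ) (he : Even e) (hle : e ≤ D.ht s) :
    Diagram (t + 1) where
  ht := Fin.insertNth (α := fun _ => ℕ) s.castSucc e D.ht
  left_boundary u hu := by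
    rcases Fin.eq_self_or_eq_succAbove s.castSucc u with rfl | ⟨w, rfl⟩
    · rw [Fin.insertNth_apply_same]
      exact Or.inl he
    · rw [Fin.insertNth_apply_succAbove] at hu ⊢
      refine (D.left_boundary w fun l hl => ?_).imp_right fun h l => ?_
      · have := hu _ (Fin.succAbove_lt_succAbove_iff.2 hl)
        rwa [Fin.insertNth_apply_succAbove] at this
      · rcases Fin.eq_self_or_eq_succAbove s.castSucc l with rfl | ⟨l, rfl⟩
        · rw [Fin.insertNth_apply_same]
          exact hle.trans (h s)
        · rw [Fin.insertNth_apply_succAbove]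
          exact h l
  right_boundary u hu := by
    rcases Fin.eq_self_or_eq_succAbove s.castSucc u with rfl | ⟨w, rfl⟩
    · have := hu _ (castSucc_lt_succAbove.2 le_rfl)
      rw [Fin.insertNth_apply_same, Fin.insertNth_apply_succAbove] at this
      omega
    · rw [Fin.insertNth_apply_succAbove] at hu ⊢
      refine (D.right_boundary w fun l hl => ?_).imp_right fun h l => ?_
      · have := hu _ (Fin.succAbove_lt_succAbove_iff.2 hl)
        rwa [Fin.insertNth_apply_succAbove] at this
      · rcases Fin.eq_self_or_eq_succAbove s.castSucc l with rfl | ⟨l, rfl⟩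
        · rw [Fin.insertNth_apply_same]
          exact hle.trans (h s)
        · rw [Fin.insertNth_apply_succAbove]
          exact h l

section ins

variable {s : Fin (t + 1)} {e : ℕ} {he : Even e} {hle : e ≤ D.ht s}

theorem ins_ht_new : (D.ins s e he hle).ht s.castSucc = e :=
  Fin.insertNth_apply_same (α := fun _ => ℕ) _ _ _

theorem ins_ht_old : (D.ins s e he hle).ht (s.castSucc.succAbove w) = D.ht w :=
  Fin.insertNth_apply_succAbove (α := fun _ => ℕ) _ _ _ _

theorem ins_ht_update {k : Fin (t + 1)} {n : ℕ} (h : D'.ht = update D.ht k n)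
    {hle' : e ≤ D'.ht s} :
    (D'.ins s e he hle').ht = update (D.ins s e he hle).ht (s.castSucc.succAbove k) n := by
  ext u
  rcases Fin.eq_self_or_eq_succAbove s.castSucc u with rfl | ⟨w, rfl⟩
  · rw [update_of_ne (Fin.succAbove_ne _ _).symm, ins_ht_new, ins_ht_new]
  · rw [ins_ht_old, h]
    by_cases q : w = k
    · subst q
      rw [update_self, update_self]
    · rw [update_of_ne q, update_of_ne fun h => q (Fin.succAbove_right_injective h), ins_ht_old]

theorem IsStronglyExtremal.ins (h : D.IsStronglyExtremal w) :
    (D.ins s e he hle).IsStronglyExtremal (s.castSucc.succAbove w) := by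
  obtain ⟨h1, h2, h3⟩ := h
  rw [IsStronglyExtremal, ins_ht_old]
  refine ⟨fun l => ?_, fun p l hl => ?_, fun p l hl => ?_⟩ <;>
    rcases Fin.eq_self_or_eq_succAbove s.castSucc l with rfl | ⟨l, rfl⟩
  · rw [ins_ht_new]
    exact hle.trans (h1 s)
  · rw [ins_ht_old]
    exact h1 l
  · rw [ins_ht_new]
    refine lt_of_le_of_ne (hle.trans (h1 s)) ?_
    rintro rfl
    exact Nat.not_even_iff_odd.2 p he
  · rw [ins_ht_old]
    exact h2 p l (Fin.succAbove_lt_succAbove_iff.1 hl)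
  · rw [ins_ht_new]
    exact hle.trans_lt (h3 p s (succAbove_lt_castSucc.1 hl))
  · rw [ins_ht_old]
    exact h3 p l (Fin.succAbove_lt_succAbove_iff.1 hl)

theorem Reduced.ins (h : D.Reduced) : (D.ins s e he hle).Reduced := by
  rintro m hm ⟨l, hl⟩
  obtain ⟨i, hi⟩ := h m hm <| by
    rcases Fin.eq_self_or_eq_succAbove s.castSucc l with rfl | ⟨l, rfl⟩
    · rw [ins_ht_new] at hl
      exact ⟨s, hl.trans hle⟩
    · rw [ins_ht_old] at hl
      exact ⟨l, hl⟩
  exact ⟨s.castSucc.succAbove i, by rw [ins_ht_old, hi]⟩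

/-- Completeness survives if the new column is as high as its parity admits. -/
theorem Complete.ins (h : D.Complete) (hs : D.ht s ≤ e + 1) : (D.ins s e he hle).Complete := by
  have old : ∀ {w k : Fin (t + 1)} {m : ℕ},
      (∀ l, s.castSucc.succAbove w < l → l < s.castSucc.succAbove k →
        (D.ins s e he hle).ht l ≤ m) → ∀ l, w < l → l < k → D.ht l ≤ m := fun H l h1 h2 => by
    have := H _ (Fin.succAbove_lt_succAbove_iff.2 h1) (Fin.succAbove_lt_succAbove_iff.2 h2)
    rwa [ins_ht_old] at this
  intro u hu
  rw [CanAdjoin] at hu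
  rcases Fin.eq_self_or_eq_succAbove s.castSucc u with rfl | ⟨w, rfl⟩
  · rw [ins_ht_new] at hu
    rcases hu with ⟨-, k, h1, h2, h3⟩ | ⟨p, -⟩
    · rcases Fin.eq_self_or_eq_succAbove s.castSucc k with rfl | ⟨k, rfl⟩
      · exact lt_irrefl _ h1
      rw [ins_ht_old] at h2
      rcases (castSucc_lt_succAbove.1 h1).eq_or_lt with rfl | hk
      · omega
      · have hse := h3 _ (castSucc_lt_succAbove.2 le_rfl) (Fin.succAbove_lt_succAbove_iff.2 hk)
        rw [ins_ht_old] at hse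
        have e' : D.ht s = e := le_antisymm hse hle
        refine h s (Or.inl ⟨e' ▸ he, k, hk, e' ▸ h2, fun l a b => ?_⟩)
        have := h3 _ (castSucc_lt_succAbove.2 a.le) (Fin.succAbove_lt_succAbove_iff.2 b)
        rwa [ins_ht_old, ← e'] at this
    · exact Nat.not_even_iff_odd.2 p he
  · rw [ins_ht_old] at hu
    rcases hu with ⟨p, k, h1, h2, h3⟩ | ⟨p, k, h1, h2, h3⟩ <;>
      rcases Fin.eq_self_or_eq_succAbove s.castSucc k with rfl | ⟨k, rfl⟩
    · rw [ins_ht_new] at h2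
      have hws := succAbove_lt_castSucc.1 h1
      refine h w (Or.inl ⟨p, s, hws, h2.trans hle, fun l a b => ?_⟩)
      have := h3 _ (Fin.succAbove_lt_succAbove_iff.2 a) (succAbove_lt_castSucc.2 b)
      rwa [ins_ht_old] at this
    · rw [ins_ht_old] at h2
      exact h w (Or.inl ⟨p, k, Fin.succAbove_lt_succAbove_iff.1 h1, h2, old h3⟩)
    · rw [ins_ht_new] at h2
      rcases (castSucc_lt_succAbove.1 h1).eq_or_lt with rfl | hk
      · omega
      · have := h3 _ (castSucc_lt_succAbove.2 le_rfl) (Fin.succAbove_lt_succAbove_iff.2 hk)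
        rw [ins_ht_old] at this
        omega
    · rw [ins_ht_old] at h2
      exact h w (Or.inr ⟨p, k, Fin.succAbove_lt_succAbove_iff.1 h1, h2, old h3⟩)

/-- The new column splits the gap on the left of `s`; the part next to it keeps the label. -/
theorem Gap.ins (h : D.Gap j x y b) :
    (D.ins s e he hle).Gap j (s.castSucc.succAbove x)
      (if y = s ∧ j ≤ e then s.castSucc else s.castSucc.succAbove y) (s.succAbove b) := by
  have nb : ∀ j x y, D.Neighbours j x y →
      (D.ins s e he hle).Neighbours j (s.castSucc.succAbove x)
        (if y = s ∧ j ≤ e then s.castSucc else s.castSucc.succAbove y) := by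
    rintro j x y ⟨h1, h2, h3, h4⟩
    split_ifs with c
    · obtain ⟨rfl, c⟩ := c
      refine ⟨succAbove_lt_castSucc.2 h1, by rwa [ins_ht_old], by rwa [ins_ht_new],
        fun l hl hl' => ?_⟩
      rcases Fin.eq_self_or_eq_succAbove y.castSucc l with rfl | ⟨l, rfl⟩
      · exact absurd hl' (lt_irrefl _)
      · rw [ins_ht_old]
        exact h4 l (Fin.succAbove_lt_succAbove_iff.1 hl) (succAbove_lt_castSucc.1 hl')
    · refine ⟨Fin.succAbove_lt_succAbove_iff.2 h1, by rwa [ins_ht_old], by rwa [ins_ht_old],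
        fun l hl hl' => ?_⟩
      rcases Fin.eq_self_or_eq_succAbove s.castSucc l with rfl | ⟨l, rfl⟩
      · rw [ins_ht_new]
        rcases (castSucc_lt_succAbove.1 hl').eq_or_lt with q | q
        · exact not_le.1 fun r => c ⟨q.symm, r⟩
        · exact hle.trans_lt (h4 s (succAbove_lt_castSucc.1 hl) q)
      · rw [ins_ht_old]
        exact h4 l (Fin.succAbove_lt_succAbove_iff.1 hl) (Fin.succAbove_lt_succAbove_iff.1 hl')
  induction j generalizing x y with
  | zero =>
    obtain ⟨rfl, rfl⟩ := h
    refine ⟨castSucc_succAbove_castSucc s b, ?_⟩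
    split_ifs with c
    · rw [← c.1, Fin.succAbove_of_castSucc_lt _ _ Fin.castSucc_lt_succ, Fin.succ_castSucc]
    · exact castSucc_succAbove_succ s b fun q => c ⟨q, Nat.zero_le _⟩
  | succ j ih =>
    refine ⟨nb _ _ _ h.1, ?_⟩
    rcases h.2 with ⟨p, z, hz⟩ | ⟨p, z, hz⟩
    · exact Or.inl ⟨p, _, ih hz⟩
    · refine Or.inr ⟨p, s.castSucc.succAbove z, ?_⟩
      -- As `j` is odd and `e` is even, the new column meets both rows `j`, `j + 1` or neither.
      have q : (y = s ∧ j + 1 ≤ e) ↔ (y = s ∧ j ≤ e) := by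
        obtain ⟨u, hu⟩ := he
        obtain ⟨v, hv⟩ := p
        constructor <;> rintro ⟨a, b⟩ <;> exact ⟨a, by omega⟩
      rw [if_congr q rfl rfl]
      exact ih hz

theorem IsMinimal.ins {α : Type*} [LinearOrder α] {c : Fin (t + 1) → α} (hs : ∀ i, c i ≤ c s)
    (h : D.IsMinimal (c ∘ s.succAbove)) : (D.ins s e he hle).IsMinimal c := by
  intro j u v β hg i hu hv
  obtain ⟨h1, h2, h3, h4⟩ := hg.neighbours
  rcases Fin.eq_self_or_eq_succAbove s i with rfl | ⟨i, rfl⟩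
  · exact hs β
  rcases Fin.eq_self_or_eq_succAbove s.castSucc u with rfl | ⟨x, rfl⟩
  · -- The gap on the right of the new column contains no index but `s`.
    rw [ins_ht_new] at h2
    have q := hg.neighbours.le_right (castSucc_lt_succAbove.2 le_rfl)
      (by rw [ins_ht_old]; omega)
    rw [castSucc_succAbove_self] at q
    rw [Fin.castSucc_le_castSucc_iff] at hu
    exact absurd (le_antisymm (Fin.succ_le_succ_iff.1 (hv.trans q)) hu) (Fin.succAbove_ne _ _)
  rw [ins_ht_old] at h2
  rw [← castSucc_succAbove_castSucc, Fin.succAbove_le_succAbove_iff] at hu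
  obtain ⟨y, hy, hiy⟩ : ∃ y, D.Neighbours j x y ∧ i.succ ≤ y := by
    rcases Fin.eq_self_or_eq_succAbove s.castSucc v with rfl | ⟨y, rfl⟩
    · rw [ins_ht_new] at h3
      refine ⟨s, ⟨succAbove_lt_castSucc.1 h1, h2, h3.trans hle, fun l hl hl' => ?_⟩, ?_⟩
      · have := h4 _ (Fin.succAbove_lt_succAbove_iff.2 hl) (succAbove_lt_castSucc.2 hl')
        rwa [ins_ht_old] at this
      · have q := Fin.castSucc_lt_succ.trans_le hv
        rw [Fin.castSucc_lt_castSucc_iff, Fin.succAbove_lt_iff_castSucc_lt] at q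
        exact Fin.castSucc_lt_iff_succ_le.1 q
    · rw [ins_ht_old] at h3
      refine ⟨y, ⟨Fin.succAbove_lt_succAbove_iff.1 h1, h2, h3, fun l hl hl' => ?_⟩, ?_⟩
      · have := h4 _ (Fin.succAbove_lt_succAbove_iff.2 hl) (Fin.succAbove_lt_succAbove_iff.2 hl')
        rwa [ins_ht_old] at this
      · have q := Fin.castSucc_lt_succ.trans_le hv
        rw [← castSucc_succAbove_castSucc, Fin.succAbove_lt_succAbove_iff] at q
        exact Fin.castSucc_lt_iff_succ_le.1 q
  obtain ⟨b, hb⟩ := hy.exists_gap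
  have hb' := hb.ins (s := s) (e := e) (he := he) (hle := hle)
  rw [← hg.neighbours.right_unique hb'.neighbours] at hb'
  rw [hg.label_unique hb']
  exact h _ _ _ _ hb i hu hiy

theorem step_ins_add_two {he' : Even (e + 2)} {hle' : e + 2 ≤ D.ht s} :
    Step (D.ins s e he hle) (D.ins s (e + 2) he' hle') := by
  refine .domino _ _ s.castSucc (Or.inl ⟨?_, s.castSucc.succAbove s,
    castSucc_lt_succAbove.2 le_rfl, ?_, fun l hl hl' => ?_⟩) ?_
  · rwa [ins_ht_new]
  · rwa [ins_ht_new, ins_ht_old]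
  · rw [castSucc_succAbove_self, Fin.lt_def, Fin.val_succ] at hl'
    rw [Fin.lt_def, Fin.val_castSucc] at hl
    omega
  · ext u
    rcases Fin.eq_self_or_eq_succAbove s.castSucc u with rfl | ⟨w, rfl⟩
    · rw [update_self, ins_ht_new, ins_ht_new]
    · rw [update_of_ne (Fin.succAbove_ne _ _), ins_ht_old, ins_ht_old]

theorem Step.ins_zero (h : Step D D') :
    Step (D.ins s 0 Even.zero (Nat.zero_le _)) (D'.ins s 0 Even.zero (Nat.zero_le _)) := by
  cases h with
  | domino i hi h =>
    refine .domino _ _ (s.castSucc.succAbove i) ?_ (by rw [ins_ht_update h, ins_ht_old])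
    rw [CanAdjoin, ins_ht_old]
    refine hi.imp ?_ ?_ <;> rintro ⟨p, k, h1, h2, h3⟩ <;>
      refine ⟨p, s.castSucc.succAbove k, Fin.succAbove_lt_succAbove_iff.2 h1, by rwa [ins_ht_old],
        fun l hl hl' => ?_⟩ <;>
      rcases Fin.eq_self_or_eq_succAbove s.castSucc l with rfl | ⟨l, rfl⟩
    · rw [ins_ht_new]
      exact Nat.zero_le _
    · rw [ins_ht_old]
      exact h3 l (Fin.succAbove_lt_succAbove_iff.1 hl) (Fin.succAbove_lt_succAbove_iff.1 hl')
    · rw [ins_ht_new]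
      exact Nat.zero_le _
    · rw [ins_ht_old]
      exact h3 l (Fin.succAbove_lt_succAbove_iff.1 hl) (Fin.succAbove_lt_succAbove_iff.1 hl')
  | halfDomino i hi h =>
    exact .halfDomino _ _ (s.castSucc.succAbove i) hi.ins (by rw [ins_ht_update h, ins_ht_old])
  | removeRows i hi h =>
    refine .removeRows _ _ i (fun l => ?_) fun l => ?_ <;>
      rcases Fin.eq_self_or_eq_succAbove s.castSucc l with rfl | ⟨l, rfl⟩
    · rw [ins_ht_new]
      exact (Nat.succ_ne_zero i).symm
    · rw [ins_ht_old]
      exact hi l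
    · rw [ins_ht_new, ins_ht_new, if_neg (by omega)]
    · rw [ins_ht_old, ins_ht_old, h]

end ins

end Diagram

namespace H

open Diagram

variable {t : ℕ} {D D' : Diagram t} {x y : H t} {w : Fin (t + 1)} {b : Fin t}

/-- The class of the diagrams that arise from those of a given class by insertion of an empty column
on the left of the column `s`. Insertion of a column of any even height not above that of `s`
gives the same class, see `mk_ins`. -/
def insert (s : Fin (t + 1)) : H t → H (t + 1) :=
  Quot.lift (fun D => mk (D.ins s 0 Even.zero (Nat.zero_le _)))
    fun _ _ h => mk_eq_of_step h.ins_zero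

variable {s : Fin (t + 1)}

theorem mk_ins {e : ℕ} (he : Even e) (hle : e ≤ D.ht s) :
    mk (D.ins s e he hle) = (mk D).insert s := by
  obtain ⟨n, rfl⟩ := id he
  induction n with
  | zero => rfl
  | succ n ih =>
    have q : n + 1 + (n + 1) = n + n + 2 := by omega
    rw [← ih ⟨n, rfl⟩ (by omega)]
    simp only [q]
    exact (mk_eq_of_step step_ins_add_two).symm

theorem label_insert : (x.insert s).label = s.castSucc.succAbove x.label := by
  induction x using Quot.ind with
  | mk D => exact label_eq_of_isStronglyExtremal (isStronglyExtremal_label D).ins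

theorem topLabel_insert_new : (x.insert s).TopLabel s.castSucc s := by
  induction x using Quot.ind with
  | mk D =>
    refine Or.inl ?_
    rw [ins_ht_new]
    exact ⟨Even.zero, _, rfl, rfl⟩

theorem TopLabel.insert (h : x.TopLabel w b) :
    (x.insert s).TopLabel (s.castSucc.succAbove w) (s.succAbove b) := by
  induction x using Quot.ind with
  | mk D =>
    change Diagram.TopLabel _ _ _
    rw [Diagram.TopLabel, ins_ht_old]
    rcases h with ⟨p, y, hy⟩ | ⟨p, y, hy⟩
    · exact Or.inl ⟨p, _, hy.ins⟩
    · refine Or.inr ⟨p, s.castSucc.succAbove y, ?_⟩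
      have := hy.ins (s := s) (e := 0) (he := Even.zero) (hle := Nat.zero_le _)
      rwa [if_neg] at this
      rintro ⟨-, q⟩
      obtain ⟨v, hv⟩ := p
      omega

theorem Linkage.insert {i : Fin t} (h : Linkage i x y) :
    Linkage (s.succAbove i) (x.insert s) (y.insert s) := by
  obtain ⟨D, D', k, rfl, rfl, hc, hr, hD', hk, hk', he⟩ := h
  have ek : D'.ht k = D.ht k + 1 := by rw [hD', update_self]
  have hle : D.ht s ≤ D'.ht s := by
    by_cases e : s = k
    · subst e
      omega
    · rw [hD', update_of_ne e]
  have p : Even (D.ht s / 2 * 2) := even_two.mul_left _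
  have q : D.ht s / 2 * 2 ≤ D.ht s := by omega
  refine ⟨D.ins s _ p q, D'.ins s _ p (q.trans hle), s.castSucc.succAbove k, mk_ins _ _,
    mk_ins _ _, hc.ins (by omega), hr.ins, ?_, fun h => ?_, hk'.ins, ?_⟩
  · rw [ins_ht_update hD', ins_ht_old]
  · obtain ⟨o, ho⟩ := D.exists_stronglyExtremal
    have := ho.ins.unique h
    rw [Fin.succAbove_right_inj] at this
    exact hk (this ▸ ho)
  · rw [ins_ht_old]
    rcases Nat.even_or_odd (D.ht k + 1) with r | r
    · obtain ⟨v, hv⟩ := (hasEntry_even r).1 he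
      have := hv.ins (s := s) (he := p) (hle := q.trans hle)
      rw [if_neg] at this
      · exact (hasEntry_even r).2 ⟨_, this⟩
      · rintro ⟨rfl, h⟩
        omega
    · obtain ⟨v, hv⟩ := (hasEntry_odd r).1 he
      exact (hasEntry_odd r).2 ⟨_, hv.ins⟩

theorem IsMinimal.insert {α : Type*} [LinearOrder α] {c : Fin (t + 1) → α} (hs : ∀ i, c i ≤ c s)
    (h : IsMinimal (c ∘ s.succAbove) x) : IsMinimal c (x.insert s) := by
  obtain ⟨D, rfl, hc, hr, hm⟩ := h
  exact ⟨D.ins s (D.ht s / 2 * 2) (even_two.mul_left _) (by omega), mk_ins _ _,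
    hc.ins (by omega), hr.ins, hm.ins hs⟩

/-- The reflected form of `H.insert`: the new column is on the right of the column `s`. -/
def insertRight (s : Fin (t + 1)) (x : H t) : H (t + 1) := (x.mirror.insert s.rev).mirror

theorem label_insertRight : (x.insertRight s).label = s.succ.succAbove x.label := by
  rw [insertRight, label_mirror, label_insert, label_mirror, ← Fin.rev_succ,
    Fin.succAbove_rev_left, Fin.rev_rev, Fin.rev_rev]

theorem topLabel_insertRight_new : (x.insertRight s).TopLabel s.succ s := by
  have := (topLabel_insert_new (x := x.mirror) (s := s.rev)).mirror
  rwa [← Fin.rev_succ, Fin.rev_rev, Fin.rev_rev] at this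

theorem TopLabel.insertRight (h : x.TopLabel w b) :
    (x.insertRight s).TopLabel (s.succ.succAbove w) (s.succAbove b) := by
  have := (h.mirror.insert (s := s.rev)).mirror
  rwa [← Fin.rev_succ, Fin.succAbove_rev_left, Fin.rev_rev, Fin.rev_rev, Fin.succAbove_rev_left,
    Fin.rev_rev, Fin.rev_rev] at this

theorem link_insert {i : Fin t} (h : (linkGraph t).link i x y) :
    (linkGraph (t + 1)).link (s.succAbove i) (x.insert s) (y.insert s) :=
  h.imp Linkage.insert Linkage.insert

theorem link_insertRight {i : Fin t} (h : (linkGraph t).link i x y) :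
    (linkGraph (t + 1)).link (s.succAbove i) (x.insertRight s) (y.insertRight s) := by
  have := link_mirror (link_insert (s := s.rev) (link_mirror h))
  rwa [Fin.succAbove_rev_left, Fin.rev_rev, Fin.rev_rev] at this

variable {α : Type*} [LinearOrder α]

theorem IsMinimal.insertRight {c : Fin (t + 1) → α} (hs : ∀ i, c i ≤ c s)
    (h : IsMinimal (c ∘ s.succAbove) x) : IsMinimal c (x.insertRight s) := by
  have e : (c ∘ s.succAbove) ∘ Fin.rev = (c ∘ Fin.rev) ∘ s.rev.succAbove := by
    ext i
    simp [Fin.succAbove_rev_left]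
  have := ((e ▸ h.mirror).insert (c := c ∘ Fin.rev) (s := s.rev) fun i => by
    simpa using hs i.rev).mirror
  rwa [comp_assoc, Fin.rev_involutive.comp_self] at this

/-- If the strongly extremal column `s` has odd height, then the two new classes have
representatives in which the columns `s` and `s + 1` have the heights `ht s - 1`, `ht s` and
`ht s`, `ht s`. -/
theorem linkage_insert_insertRight (hc : D.Complete) (hr : D.Reduced) (hs : D.IsStronglyExtremal s)
    (p : Odd (D.ht s)) : Linkage s ((mk D).insert s) ((mk D).insertRight s) := by
  obtain ⟨g, hg⟩ : ∃ g, D.ht s = g + 1 := ⟨D.ht s - 1, by obtain ⟨a, ha⟩ := p; omega⟩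
  have pg : Even g := by
    rw [hg, Nat.odd_add_one, Nat.not_odd_iff_even] at p
    exact p
  have hle : g + 2 ≤ D.mirror.ht s.rev := by rw [mirror_ht_rev]; omega
  have pg2 : Even (g + 2) := pg.add even_two
  obtain ⟨Y, hY⟩ := exists_mirror_eq (D := D.mirror.ins s.rev (g + 2) pg2 hle) fun u => by
    rcases Fin.eq_self_or_eq_succAbove s.rev.castSucc u with rfl | ⟨w, rfl⟩
    · rw [ins_ht_new]
      omega
    · rw [ins_ht_old, mirror_ht]
      omega
  have hmk : mk Y = (mk D).insertRight s := by
    rw [← mirror_mk_mirror Y, hY, mk_ins, insertRight, mirror_mk]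
  have hnew : Y.ht s.succ = g + 1 := by
    have : Y.mirror.ht s.rev.castSucc = g + 2 := by rw [hY, ins_ht_new]
    rw [← Fin.rev_succ, mirror_ht_rev] at this
    omega
  have hold : ∀ w, Y.ht (s.succ.succAbove w) = D.ht w := fun w => by
    have : Y.mirror.ht (s.rev.castSucc.succAbove w.rev) = D.mirror.ht w.rev := by
      rw [hY, ins_ht_old]
    rw [← Fin.rev_succ, Fin.succAbove_rev_left, Fin.rev_rev, mirror_ht_rev, mirror_ht_rev] at this
    omega
  have hself : Y.ht s.castSucc = g + 1 := by rw [← succ_succAbove_self, hold, hg]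
  refine ⟨D.ins s g pg (by omega), Y, s.castSucc, mk_ins _ _, hmk, hc.ins hg.le, hr.ins, ?_,
    fun h => ?_, ?_, ?_⟩
  · ext u
    rcases Fin.eq_self_or_eq_succAbove s.castSucc u with rfl | ⟨w, rfl⟩
    · rw [update_self, ins_ht_new, hself]
    · rw [update_of_ne (Fin.succAbove_ne _ _), ins_ht_old]
      by_cases e : w = s
      · subst e
        rw [castSucc_succAbove_self, hnew, hg]
      · rw [castSucc_succAbove_of_ne e, hold]
  · exact Fin.succAbove_ne _ _ (hs.ins.unique h)
  · rw [IsStronglyExtremal, hself]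
    refine ⟨fun u => ?_, fun _ u hu => ?_, fun q => absurd pg.add_one (Nat.not_odd_iff_even.2 q)⟩
    · rcases Fin.eq_self_or_eq_succAbove s.succ u with rfl | ⟨w, rfl⟩
      · rw [hnew]
      · rw [hold, ← hg]
        exact hs.1 w
    · rcases Fin.eq_self_or_eq_succAbove s.succ u with rfl | ⟨w, rfl⟩
      · exact absurd hu (not_lt.2 Fin.castSucc_lt_succ.le)
      · rw [hold, ← hg]
        refine hs.2.1 p w ?_
        rwa [← succ_succAbove_self, Fin.succAbove_lt_succAbove_iff] at hu
  · rw [ins_ht_new]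
    exact (hasEntry_odd pg.add_one).2 ⟨_, gap_adjacent hself.ge hnew.ge⟩

theorem link_insert_insertRight {c : Fin t → α} (h : IsMinimal c x) (hs : x.label = s) :
    (linkGraph (t + 1)).link s (x.insert s) (x.insertRight s) := by
  obtain ⟨D, rfl, hc, hr, hm⟩ := h
  have hD : D.IsStronglyExtremal s := hs ▸ isStronglyExtremal_label D
  rcases Nat.even_or_odd (D.ht s) with p | p
  · obtain ⟨X, hX, hXc, hXr, -, hodd⟩ := exists_reduced_mirror hc hr hm
    have hXs : X.IsStronglyExtremal s.rev := by
      have := isStronglyExtremal_label X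
      rwa [hX, label_mirror, hs] at this
    have := (linkage_insert_insertRight hXc hXr hXs (hodd s p)).mirror
    rw [hX, insertRight, mirror_mirror, mirror_mirror, Fin.rev_rev] at this
    exact Or.inr this
  · exact Or.inl (linkage_insert_insertRight hc hr hD p)

end H

/-! ### Markings and pointed chains -/

theorem rFun_apply_of_lt {t : ℕ} {a k : Fin (t + 1)} (h : k < a) : rFun a k = 0 := by
  rw [rFun, Finset.sum_apply]
  refine Finset.sum_eq_zero fun l hl => ?_
  rw [Finset.mem_filter] at hl
  have h1 : k < l.castSucc := h.trans_le hl.2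
  rw [Pi.add_apply, Pi.single_eq_of_ne h1.ne,
    Pi.single_eq_of_ne (h1.trans Fin.castSucc_lt_succ).ne, add_zero]

theorem rFun_apply_self {t : ℕ} (b : Fin t) : rFun b.castSucc b.castSucc = 1 := by
  have h := congrFun (rFun_sub b) b.castSucc
  rw [Pi.sub_apply, Pi.add_apply, rFun_apply_of_lt Fin.castSucc_lt_succ, Pi.single_eq_same,
    Pi.single_eq_of_ne Fin.castSucc_lt_succ.ne] at h
  simpa using h

theorem rFun_injective {t : ℕ} : Injective (rFun (t := t)) := by
  have key : ∀ a b : Fin (t + 1), a < b → rFun a ≠ rFun b := fun a b h e => by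
    obtain ⟨a, rfl⟩ := Fin.exists_castSucc_eq.2 (h.trans_le (Fin.le_last b)).ne
    have := congrFun e a.castSucc
    rw [rFun_apply_self, rFun_apply_of_lt h] at this
    exact one_ne_zero this
  intro a b e
  rcases lt_trichotomy a b with h | h | h
  · exact absurd e (key a b h)
  · exact h
  · exact absurd e.symm (key b a h)

namespace LGraph

variable {t : ℕ} {V : Type*} {G : LGraph t V} {z : V → Fin t → Fin (t + 1)}

/-- A marking attaches to every vertex one vertex label `z v j` for each edge label `j`, other than
the label of the vertex. Along an edge with label `i`, the label of the vertex and its `i`-th mark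
are exchanged, and the other marks do not change. The marks amount to an evaluation, where
`- r^{z v j}` is the coefficient of `c_j` up to a constant. -/
structure IsMarking (G : LGraph t V) (z : V → Fin t → Fin (t + 1)) : Prop where
  mark_eq : ∀ i v w, G.link i v w → z v i = G.label w
  mark_eq_of_ne : ∀ i v w, G.link i v w → ∀ j, j ≠ i → z v j = z w j
  mark_ne : ∀ v j, z v j ≠ G.label v
  injective : Injective z

/-- The graph is connected: a non-empty set of vertices that is closed under links contains all
vertices. -/
def IsConnected (G : LGraph t V) : Prop :=
  ∀ P : V → Prop, (∀ i v w, G.link i v w → P v → P w) → ∀ v w, P v → P w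

/-- Along a pointed chain every mark changes just once. -/
theorem IsPointedChain.mark {p : Fin (t + 1) → V} (hp : G.IsPointedChain p) (hz : G.IsMarking z)
    (k : Fin (t + 1)) (j : Fin t) : z (p k) j = if k ≤ j.castSucc then j.succ else j.castSucc := by
  induction k using Fin.reverseInduction with
  | last =>
    -- The mark is constant from the end of the chain down to the edge with label `j`.
    have : ∀ i : Fin (t + 1), j.castSucc < i → z (p i) j = j.castSucc := by
      intro i
      induction i using Fin.induction with
      | zero => exact fun h => absurd h (Fin.not_lt_zero _)
      | succ i ih =>
        intro h
        rcases (Fin.castSucc_lt_succ_iff.1 h).eq_or_lt with rfl | h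
        · rw [hz.mark_eq _ _ _ (hp.2 j), hp.1]
        · rw [hz.mark_eq_of_ne _ _ _ (hp.2 i) j h.ne, ih (Fin.castSucc_lt_castSucc_iff.2 h)]
    rw [this _ (Fin.castSucc_lt_last j), if_neg (not_le.2 (Fin.castSucc_lt_last j))]
  | cast k ih =>
    have hl := G.symm _ _ _ (hp.2 k)
    by_cases e : j = k
    · subst e
      rw [hz.mark_eq _ _ _ hl, hp.1, if_pos le_rfl]
    · rw [hz.mark_eq_of_ne _ _ _ hl j e, ih]
      refine if_congr ?_ rfl rfl
      rw [Fin.succ_le_castSucc_iff, Fin.castSucc_le_castSucc_iff]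
      exact ⟨le_of_lt, fun h => lt_of_le_of_ne h (Ne.symm e)⟩

theorem IsEvaluation.eq_of_eq {f f' : V → HHat t} (hG : G.IsConnected) (hf : G.IsEvaluation f)
    (hf' : G.IsEvaluation f') {v : V} (h : f v = f' v) : f = f' := by
  funext w
  refine hG (fun v => f v = f' v) (fun i v w hl e => ?_) v w h
  have h1 := hf i v w hl
  rw [← hf' i v w hl, e] at h1
  exact sub_right_injective h1

theorem IsMarking.p9 (hz : G.IsMarking z) (hG : G.IsConnected) {p : Fin (t + 1) → V}
    (hp : G.IsPointedChain p) : G.P9 := by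
  let f : V → HHat t := fun v k j =>
    hFun t k j + rFun (z (p (Fin.last t)) j) k - rFun (z v j) k
  have hf : G.IsEvaluation f := by
    intro i v w hl
    funext k j
    simp only [f, Pi.sub_apply, cDiff]
    by_cases e : j = i
    · subst e
      rw [if_pos rfl, hz.mark_eq _ _ _ hl, hz.mark_eq _ _ _ (G.symm _ _ _ hl)]
      ring
    · rw [if_neg e, hz.mark_eq_of_ne _ _ _ hl j e]
      ring
  have hf0 : f (p (Fin.last t)) = hFun t := by
    funext k j
    simp [f]
  refine ⟨p, hp, fun p' hp' => funext fun k => hz.injective (funext fun j => ?_), f, ⟨hf, hf0⟩,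
    fun f' ⟨h, h0⟩ => h.eq_of_eq hG hf (h0.trans hf0.symm), fun v w e => hz.injective ?_⟩
  · rw [hp.mark hz, hp'.mark hz]
  · funext j
    refine rFun_injective (funext fun k => ?_)
    have := congrFun (congrFun e k) j
    simpa [f] using this

/-! ### Fusion -/

section fusion

variable (s : Fin (t + 1))

/-- The pointed chain of a fusion runs through the copy `G⁺`, changes to the copy `G⁻` by the edge
with label `s`, and goes on there. -/
theorem IsPointedChain.fusion {p : Fin (t + 1) → V} (hp : G.IsPointedChain p) :
    (G.fusion s).IsPointedChain fun i =>
      if i ≤ s.castSucc then Sum.inr (p (s.predAbove i)) else Sum.inl (p (s.predAbove i)) := by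
  refine ⟨fun i => ?_, fun i => ?_⟩
  · beta_reduce
    split_ifs with h
    · change s.succ.succAbove (G.label _) = i
      rw [hp.1, Fin.succ_succAbove_predAbove (h.trans_lt Fin.castSucc_lt_succ).ne]
    · change s.castSucc.succAbove (G.label _) = i
      rw [hp.1, Fin.succAbove_predAbove (not_le.1 h).ne']
  · beta_reduce
    rcases Fin.eq_self_or_eq_succAbove s i with rfl | ⟨j, rfl⟩
    · rw [if_neg (not_le.2 Fin.castSucc_lt_succ), if_pos le_rfl, Fin.predAbove_succ_self,
        Fin.predAbove_castSucc_self]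
      exact ⟨rfl, rfl, by rw [hp.1, castSucc_succAbove_self]⟩
    · have e : s.predAbove (s.succAbove j).succ = j.succ := by
        rw [← Fin.succ_succAbove_succ]
        by_cases h : j.succ = s
        · rw [h, succ_succAbove_self, Fin.predAbove_castSucc_self]
        · rw [← castSucc_succAbove_of_ne h, Fin.predAbove_succAbove]
      have e' : s.predAbove (s.succAbove j).castSucc = j.castSucc := by
        rw [← castSucc_succAbove_castSucc, Fin.predAbove_succAbove]
      rw [e, e']
      rcases lt_or_ge j.castSucc s with h | h
      · rw [Fin.succAbove_of_castSucc_lt _ _ h, if_pos, if_pos]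
        · exact ⟨j, (Fin.succAbove_of_castSucc_lt _ _ h).symm, hp.2 j⟩
        · exact Fin.castSucc_le_castSucc_iff.2 h.le
        · exact Fin.succ_le_castSucc_iff.2 h
      · rw [Fin.succAbove_of_le_castSucc _ _ h, if_neg, if_neg]
        · exact ⟨j, (Fin.succAbove_of_le_castSucc _ _ h).symm, hp.2 j⟩
        · rw [Fin.castSucc_le_castSucc_iff, not_le]
          exact h.trans_lt Fin.castSucc_lt_succ
        · rw [Fin.succ_le_castSucc_iff, not_lt]
          exact h.trans Fin.castSucc_lt_succ.le

theorem IsConnected.fusion (hG : G.IsConnected) {u : V} (hu : G.label u = s) :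
    (G.fusion s).IsConnected := by
  intro P hP
  have hl : (G.fusion s).link s (Sum.inl u) (Sum.inr u) :=
    ⟨rfl, rfl, by rw [hu, castSucc_succAbove_self]⟩
  have h1 : ∀ v w, P (Sum.inl v) → P (Sum.inl w) :=
    hG (fun v => P (Sum.inl v)) fun i v w h => hP (s.succAbove i) _ _ ⟨i, rfl, h⟩
  have h2 : ∀ v w, P (Sum.inr v) → P (Sum.inr w) :=
    hG (fun v => P (Sum.inr v)) fun i v w h => hP (s.succAbove i) _ _ ⟨i, rfl, h⟩
  rintro (v | v) (w | w) h
  · exact h1 v w h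
  · exact h2 u w (hP s _ _ hl (h1 v u h))
  · exact h1 u w (hP s _ _ ((G.fusion s).symm _ _ _ hl) (h2 v u h))
  · exact h2 v w h

/-- The marks on a fusion: the old marks are changed like the vertex labels, and the mark that
belongs to `s` is the vertex label which does not occur in the copy at hand. -/
def fusionMark (z : V → Fin t → Fin (t + 1)) : V ⊕ V → Fin (t + 1) → Fin (t + 2)
  | Sum.inl v => s.insertNth (α := fun _ => Fin (t + 2)) s.castSucc
      fun j => s.castSucc.succAbove (z v j)
  | Sum.inr v => s.insertNth (α := fun _ => Fin (t + 2)) s.succ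
      fun j => s.succ.succAbove (z v j)

theorem fusionMark_inl_self (v : V) : fusionMark s z (Sum.inl v) s = s.castSucc :=
  Fin.insertNth_apply_same (α := fun _ => Fin (t + 2)) _ _ _

theorem fusionMark_inr_self (v : V) : fusionMark s z (Sum.inr v) s = s.succ :=
  Fin.insertNth_apply_same (α := fun _ => Fin (t + 2)) _ _ _

theorem fusionMark_inl_succAbove (v : V) (j : Fin t) :
    fusionMark s z (Sum.inl v) (s.succAbove j) = s.castSucc.succAbove (z v j) :=
  Fin.insertNth_apply_succAbove (α := fun _ => Fin (t + 2)) _ _ _ _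

theorem fusionMark_inr_succAbove (v : V) (j : Fin t) :
    fusionMark s z (Sum.inr v) (s.succAbove j) = s.succ.succAbove (z v j) :=
  Fin.insertNth_apply_succAbove (α := fun _ => Fin (t + 2)) _ _ _ _

theorem IsMarking.fusion (hz : G.IsMarking z) : (G.fusion s).IsMarking (fusionMark s z) where
  mark_eq := by
    rintro i (v | v) (w | w) h
    · obtain ⟨j, rfl, h⟩ := h
      simp only [fusionMark_inl_succAbove, hz.mark_eq _ _ _ h, LGraph.fusion]
    · obtain ⟨rfl, rfl, h⟩ := h
      rw [← castSucc_succAbove_self, Fin.succAbove_right_inj] at h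
      simp only [fusionMark_inl_self, LGraph.fusion, h, succ_succAbove_self]
    · obtain ⟨rfl, rfl, h⟩ := h
      simp only [fusionMark_inr_self, LGraph.fusion, h]
    · obtain ⟨j, rfl, h⟩ := h
      simp only [fusionMark_inr_succAbove, hz.mark_eq _ _ _ h, LGraph.fusion]
  mark_eq_of_ne := by
    -- The two copies of a vertex with label `s` have the same marks because `s` is not among them.
    have cross : ∀ v, s.castSucc.succAbove (G.label v) = s.succ → ∀ j,
        s.castSucc.succAbove (z v j) = s.succ.succAbove (z v j) := fun v h j => by
      rw [← castSucc_succAbove_self, Fin.succAbove_right_inj] at h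
      exact castSucc_succAbove_of_ne (h ▸ hz.mark_ne v j)
    rintro i (v | v) (w | w) h k hk
    · obtain ⟨j, rfl, h⟩ := h
      rcases Fin.eq_self_or_eq_succAbove s k with rfl | ⟨k, rfl⟩
      · simp only [fusionMark_inl_self]
      · simp only [fusionMark_inl_succAbove,
          hz.mark_eq_of_ne _ _ _ h k fun e => hk (e ▸ rfl)]
    · obtain ⟨rfl, rfl, h⟩ := h
      obtain ⟨k, rfl⟩ := Fin.exists_succAbove_eq hk
      simp only [fusionMark_inl_succAbove, fusionMark_inr_succAbove, cross v h]
    · obtain ⟨rfl, rfl, h⟩ := h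
      obtain ⟨k, rfl⟩ := Fin.exists_succAbove_eq hk
      simp only [fusionMark_inl_succAbove, fusionMark_inr_succAbove, cross v h]
    · obtain ⟨j, rfl, h⟩ := h
      rcases Fin.eq_self_or_eq_succAbove s k with rfl | ⟨k, rfl⟩
      · simp only [fusionMark_inr_self]
      · simp only [fusionMark_inr_succAbove,
          hz.mark_eq_of_ne _ _ _ h k fun e => hk (e ▸ rfl)]
  mark_ne := by
    rintro (v | v) k <;> rcases Fin.eq_self_or_eq_succAbove s k with rfl | ⟨k, rfl⟩
    · simp only [fusionMark_inl_self]
      exact (Fin.succAbove_ne _ _).symm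
    · simp only [fusionMark_inl_succAbove]
      exact fun h => hz.mark_ne v k (Fin.succAbove_right_injective h)
    · simp only [fusionMark_inr_self]
      exact (Fin.succAbove_ne _ _).symm
    · simp only [fusionMark_inr_succAbove]
      exact fun h => hz.mark_ne v k (Fin.succAbove_right_injective h)
  injective := by
    have ne : s.castSucc ≠ s.succ := Fin.castSucc_lt_succ.ne
    rintro (v | v) (w | w) h
    · refine congrArg Sum.inl (hz.injective (funext fun k => ?_))
      have := congrFun h (s.succAbove k)
      simpa only [fusionMark_inl_succAbove, fusionMark_inr_succAbove, Fin.succAbove_right_inj]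
        using this
    · have := congrFun h s
      simp only [fusionMark_inl_self, fusionMark_inr_self] at this
      exact absurd this ne
    · have := congrFun h s
      simp only [fusionMark_inl_self, fusionMark_inr_self] at this
      exact absurd this.symm ne
    · refine congrArg Sum.inr (hz.injective (funext fun k => ?_))
      have := congrFun h (s.succAbove k)
      simpa only [fusionMark_inl_succAbove, fusionMark_inr_succAbove, Fin.succAbove_right_inj]
        using this

end fusion

end LGraph

open LGraph

variable {α : Type*} [LinearOrder α]

theorem exists_isPointedChain_fusionGraph (t : ℕ) (c : Fin t → α) :
    ∃ p, (fusionGraph t c).IsPointedChain p := by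
  induction t with
  | zero => exact ⟨fun _ => (), fun i => (Fin.fin_one_eq_zero i).symm, fun i => i.elim0⟩
  | succ t ih =>
    obtain ⟨p, hp⟩ := ih (c ∘ (argmax c).succAbove)
    exact ⟨_, hp.fusion (argmax c)⟩

theorem isConnected_fusionGraph (t : ℕ) (c : Fin t → α) : (fusionGraph t c).IsConnected := by
  induction t with
  | zero => exact fun P _ v w h => h
  | succ t ih =>
    obtain ⟨p, hp⟩ := exists_isPointedChain_fusionGraph t (c ∘ (argmax c).succAbove)
    exact (ih _).fusion (argmax c) (hp.1 (argmax c))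

/-- The marking of `G(c)`. -/
noncomputable def mark : (t : ℕ) → (Fin t → α) → FusionVertex t → Fin t → Fin (t + 1)
  | 0, _ => fun _ j => j.elim0
  | t + 1, c => fusionMark (argmax c) (mark t (c ∘ (argmax c).succAbove))

theorem isMarking_mark (t : ℕ) (c : Fin t → α) : (fusionGraph t c).IsMarking (mark t c) := by
  induction t with
  | zero => exact ⟨fun i => i.elim0, fun i => i.elim0, fun _ j => j.elim0, fun _ _ _ => rfl⟩
  | succ t ih => exact (ih _).fusion (argmax c)

/-! ### The embedding -/

/-- The class attached to a vertex of `G(c)`: fusion at `s` corresponds to the insertion of a column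
on the left or on the right of the column `s`. -/
noncomputable def toH : (t : ℕ) → (Fin t → α) → FusionVertex t → H t
  | 0, _ => fun _ => H.mk
      { ht := fun _ => 0
        left_boundary := fun _ _ => Or.inr fun _ => le_rfl
        right_boundary := fun _ _ => Or.inr fun _ => le_rfl }
  | t + 1, c => Sum.elim
      (fun v => (toH t (c ∘ (argmax c).succAbove) v).insert (argmax c))
      (fun v => (toH t (c ∘ (argmax c).succAbove) v).insertRight (argmax c))

theorem isMinimal_toH (t : ℕ) (c : Fin t → α) (v : FusionVertex t) :
    (toH t c v).IsMinimal c := by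
  induction t with
  | zero =>
    refine ⟨_, rfl, ?_, ?_, fun _ _ _ b => b.elim0⟩
    · rintro i (⟨-, k, hk, -⟩ | ⟨-, k, hk, -⟩)
      · exact absurd hk (by omega)
      · exact absurd hk (by omega)
    · rintro m hm ⟨l, hl⟩
      exact absurd (hm.trans hl) (Nat.not_succ_le_zero 0)
  | succ t ih =>
    rcases v with v | v
    · exact (ih _ v).insert (le_argmax c)
    · exact (ih _ v).insertRight (le_argmax c)

theorem label_toH (t : ℕ) (c : Fin t → α) (v : FusionVertex t) :
    (toH t c v).label = (fusionGraph t c).label v := by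
  induction t with
  | zero => exact Fin.fin_one_eq_zero _
  | succ t ih =>
    rcases v with v | v
    · exact H.label_insert.trans (congrArg _ (ih _ v))
    · exact H.label_insertRight.trans (congrArg _ (ih _ v))

theorem link_toH (t : ℕ) (c : Fin t → α) (i : Fin t) (v w : FusionVertex t)
    (h : (fusionGraph t c).link i v w) : (linkGraph t).link i (toH t c v) (toH t c w) := by
  induction t with
  | zero => exact i.elim0
  | succ t ih =>
    have cross : ∀ v, (argmax c).castSucc.succAbove
        ((fusionGraph t (c ∘ (argmax c).succAbove)).label v) = (argmax c).succ →
        (linkGraph (t + 1)).link (argmax c) (toH (t + 1) c (Sum.inl v))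
          (toH (t + 1) c (Sum.inr v)) := fun v h => by
      rw [← castSucc_succAbove_self, Fin.succAbove_right_inj, ← label_toH] at h
      exact H.link_insert_insertRight (isMinimal_toH t _ v) h
    rcases v with v | v <;> rcases w with w | w
    · obtain ⟨j, rfl, h⟩ := h
      exact H.link_insert (ih _ _ _ _ h)
    · obtain ⟨rfl, rfl, h⟩ := h
      exact cross v h
    · obtain ⟨rfl, rfl, h⟩ := h
      exact (linkGraph (t + 1)).symm _ _ _ (cross v h)
    · obtain ⟨j, rfl, h⟩ := h
      exact H.link_insertRight (ih _ _ _ _ h)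

/-- The marks of a vertex are the columns with the corresponding labels. -/
theorem topLabel_toH (t : ℕ) (c : Fin t → α) (v : FusionVertex t) (b : Fin t) :
    (toH t c v).TopLabel (mark t c v b) b := by
  induction t with
  | zero => exact b.elim0
  | succ t ih =>
    rcases Fin.eq_self_or_eq_succAbove (argmax c) b with rfl | ⟨b, rfl⟩ <;> rcases v with v | v
    · refine Eq.subst (motive := fun w => H.TopLabel _ w _) (fusionMark_inl_self _ v).symm ?_
      exact H.topLabel_insert_new
    · refine Eq.subst (motive := fun w => H.TopLabel _ w _) (fusionMark_inr_self _ v).symm ?_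
      exact H.topLabel_insertRight_new
    · refine Eq.subst (motive := fun w => H.TopLabel _ w _)
        (fusionMark_inl_succAbove _ v b).symm ?_
      exact (ih _ v b).insert
    · refine Eq.subst (motive := fun w => H.TopLabel _ w _)
        (fusionMark_inr_succAbove _ v b).symm ?_
      exact (ih _ v b).insertRight

theorem toH_injective (t : ℕ) (c : Fin t → α) : Injective (toH t c) := fun v w h =>
  (isMarking_mark t c).injective <| funext fun b =>
    (topLabel_toH t c v b).col_unique (h ▸ topLabel_toH t c w b)

end Crystal

theorem proposition8p2 {α : Type*} [LinearOrder α] (t : ℕ) (c : Fin t → α)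
    (hc : Function.Injective c) :
    (∃ θ : Crystal.FusionVertex t → Crystal.HSet c,
      Crystal.IsLabelledEmbedding (Crystal.fusionGraph t c)
        ((Crystal.linkGraph t).restrict (Crystal.HSet c)) θ) ∧
    (Crystal.fusionGraph t c).P9 := by
  obtain ⟨p, hp⟩ := Crystal.exists_isPointedChain_fusionGraph t c
  refine ⟨⟨fun v => ⟨Crystal.toH t c v, (Crystal.isMinimal_toH t c v).mem_hSet hc⟩, ?_, ?_, ?_⟩,
    (Crystal.isMarking_mark t c).p9 (Crystal.isConnected_fusionGraph t c) hp⟩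
  · exact fun v w h => Crystal.toH_injective t c (congrArg Subtype.val h)
  · exact Crystal.label_toH t c
  · intro i v w h i'
    have hl := Crystal.link_toH t c i v w h
    refine ⟨fun h' => ?_, fun e => e ▸ hl⟩
    exact (Crystal.H.link_topLabel h').label_unique (Crystal.H.link_topLabel hl)
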